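/- **Definitions.** Bracket expressions are built from the symbols $A,B$ by $(x,y)\mapsto[x,y]$. Put $\mathrm{order}(A)=\mathrm{order}(B)=1$, $\mathrm{order}([x,y])=\mathrm{order}(x)+\mathrm{order}(y)$, $\mathrm{degree}(A)=2$, $\mathrm{degree}(B)=0$, $\mathrm{degree}([x,y])=\max(\mathrm{degree}(x)+\mathrm{degree}(y)-1,0)$. The Lie algebra of classical mechanics is $L_{\mathfrak P}(A,B)=L(A,B)/\mathcal I$, where $L(A,B)$ is the free real Lie algebra on $A,B$ and $\mathcal I$ is the ideal generated by the brackets of elements of degree $0$ (linear combinations of bracket expressions of degree $0$). Write $[X_m\cdots X_1A]=[X_m,[\dots,[X_1,A]\dots]]$. Fix a total order on bracket expressions that compares first the degree, then the order, and breaks ties arbitrarily. Let $\mathcal H$ be the corresponding generalized Hall basis of $L(A,B)$: it consists of $A$, $B$, the brackets $[x,y]$ with $x\in\mathcal H$, $y\in\{A,B\}$, $x<y$, and the brackets $[x,[y,z]]$ with $x,[y,z]\in\mathcal H$, $[y,z]>x\ge y$. Let $\mathcal B\subset\mathcal H$ consist of $A$, $B$ and all $[x,y]\in\mathcal H$ with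 $x,y\in\mathcal B$ and $\mathrm{degree}(y)>0$. Enumerate $\mathcal B=\{U_1,U_2,\dots\}$ without repetition so that $U_1=A$, $U_2=B$, and the elements of order $n$ are exactly the $U_i$ with $d_{n-1}<i\le d_n$ ($d_0=0$). Let $L_{\mathfrak P}(A,B;n)$ be the span in $L_{\mathfrak P}(A,B)$ of $U_1,\dots,U_{d_n}$. A smooth mechanical system with $d\geq 1$ degrees of freedom is a pair $T(p,q)=\frac12M(q)(p,p)$, $V=V(q)$, $p,q\in\mathbb R^d$, with $V$ smooth and $M(q)$ a symmetric bilinear form depending smoothly on $q$ (no definiteness is required). $\Phi_{T,V}$ is the Lie algebra homomorphism from $L_{\mathfrak P}(A,B)$ to the smooth functions of $(p,q)$ that are polynomial in $p$, with the bracket $\{F,G\}=\sum_i\frac{\partial F}{\partial q_i}\frac{\partial G}{\partial p_i}-\frac{\partial F}{\partial p_i}\frac{\partial G}{\partial q_i}$, such that $\Phi_{T,V}(A)=T$ and $\Phi_{T,V}(B)=V$. For $i\ge3$ define the monomial $W_i(p,q)$ by - $W_i=q_ip_{j_1}p_{j_2}$ if $U_i=[U_{j_2}U_{j_1}A]$ with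 $\mathrm{degree}(U_{j_1})=\mathrm{degree}(U_{j_2})=0$; - $W_i=p_ip_{j}$ if $U_i=[U_{j},A]$ with $\mathrm{degree}(U_{j})=0$; - $W_i=p_ip_{j_1}q_{j_2}\cdots q_{j_m}$ if $U_i=[U_{j_m}\cdots U_{j_1}A]$, $m\ge2$, $\mathrm{degree}(U_{j_1})=0<\mathrm{degree}(U_{j_2})$; - $W_i=p_0p_iq_{j_1}\cdots q_{j_m}$ if $U_i=[U_{j_m}\cdots U_{j_1}A]$, $m\ge1$, $\mathrm{degree}(U_{j_1})>0$. **Theorem.** Such total orders and enumerations exist. For every choice of them, the images of $U_1,U_2,\dots$ form a basis of $L_{\mathfrak P}(A,B)$, and for every $n\ge1$ the functions $$V(q)=q_2,\qquad T(p,q)=p_0p_1+\sum_{i=3}^{d_n}W_i(p,q),\qquad p=(p_0,\dots,p_{d_n}),\ q=(q_0,\dots,q_{d_n}),$$ define a mechanical system with $d_n+1$ degrees of freedom such that: 1. for $1\le i,j\le d_n$, the number $\left(\frac{\partial}{\partial p_i}+\frac{\partial}{\partial q_i}\right)\Phi_{T,V}(U_j)$, evaluated at $p=(1,0,\dots,0)$,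 $q=(0,\dots,0)$, is nonzero if and only if $i=j$; 2. $\ker\Phi_{T,V}\cap L_{\mathfrak P}(A,B;n)=0$. Consequently, the intersection of the kernels of $\Phi_{T,V}$ over all smooth mechanical systems with any number $d\ge1$ of degrees of freedom is $0$. -/

import Mathlib

open scoped ContDiff

namespace MechLie

noncomputable section

/-! ### Bracket expressions in `A` and `B` -/

/-- The two generators. -/
inductive Gen
  | A
  | B

/-- Formal bracket expressions in the generators `A` and `B`; `br x y` stands for `[x, y]`. -/
inductive LieTree
  | A
  | B
  | br (x y : LieTree)

namespace LieTree

/-- `degree A = 2`, `degree B = 0`, `degree [x, y] = max (degree x + degree y - 1) 0`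
(the subtraction of natural numbers is truncated). -/
def degree : LieTree → ℕ
  | A => 2
  | B => 0
  | br x y => x.degree + y.degree - 1

/-- The order is the number of generators in the expression. -/
def order : LieTree → ℕ
  | A => 1
  | B => 1
  | br x y => x.order + y.order

/-- The element of the free Lie algebra `L(A, B)` which the expression denotes. -/
def eval : LieTree → FreeLieAlgebra ℝ Gen
  | A => FreeLieAlgebra.of ℝ Gen.A
  | B => FreeLieAlgebra.of ℝ Gen.B
  | br x y => ⁅x.eval, y.eval⁆

/-- The factors of `[x_m, [x_{m-1}, ..., [x_1, A]...]]`, listed as `[x_1, ..., x_m]`. -/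
def factors : LieTree → List LieTree
  | A => []
  | B => []
  | br x y => y.factors ++ [x]

end LieTree

/-! ### The Lie algebra of classical mechanics -/

/-- The subspace of `L(A, B)` spanned by the bracket expressions of degree `n`. -/
def degreeSpan (n : ℕ) : Submodule ℝ (FreeLieAlgebra ℝ Gen) :=
  Submodule.span ℝ {z | ∃ t : LieTree, t.degree = n ∧ z = t.eval}

/-- The Lie ideal of `L(A, B)` generated by the brackets of elements of degree zero. -/
def degreeIdeal : LieIdeal ℝ (FreeLieAlgebra ℝ Gen) :=
  LieSubmodule.lieSpan ℝ (FreeLieAlgebra ℝ Gen)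
    {z | ∃ x ∈ degreeSpan 0, ∃ y ∈ degreeSpan 0, z = ⁅x, y⁆}

/-- The Lie algebra of classical mechanics: the quotient of the free Lie algebra on `A` (of
degree 2) and `B` (of degree 0) by the ideal generated by the brackets of elements of degree 0.
It is the free object on `A` and `B` among the Lie algebras `L = ⨁_{n ≥ 0} L_n` with
`[L_n, L_m] ⊆ L_{n+m-1}` for `(n, m) ≠ (0, 0)` and `[L_0, L_0] = 0`. -/
abbrev LP : Type := FreeLieAlgebra ℝ Gen ⧸ degreeIdeal

/-- The element of the Lie algebra of classical mechanics which a bracket expression denotes. -/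
def LieTree.toLP (t : LieTree) : LP := LieSubmodule.Quotient.mk t.eval

/-! ### The generalized Hall basis -/

/-- A total order on bracket expressions which compares the degree first, then the order, and
breaks the remaining ties in an arbitrary way. -/
structure IsHallOrder (lt : LieTree → LieTree → Prop) : Prop where
  strictTotal : IsStrictTotalOrder LieTree lt
  of_degree_lt : ∀ x y, x.degree < y.degree → lt x y
  of_order_lt : ∀ x y, x.degree = y.degree → x.order < y.order → lt x y

/-- The generalized Hall basis of `L(A, B)` for a given order: the generators, the brackets
`[x, y]` with `x < y` for a generator `y`, and the brackets `[x, [y, z]]` with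
`[y, z] > x ≥ y`, where `x`, `y` and `[y, z]` are in the Hall basis. -/
inductive Hall (lt : LieTree → LieTree → Prop) : LieTree → Prop
  | A : Hall lt LieTree.A
  | B : Hall lt LieTree.B
  | brA (x : LieTree) : Hall lt x → lt x LieTree.A → Hall lt (LieTree.br x LieTree.A)
  | brB (x : LieTree) : Hall lt x → lt x LieTree.B → Hall lt (LieTree.br x LieTree.B)
  | brbr (x y z : LieTree) : Hall lt x → Hall lt (LieTree.br y z) →
      lt x (LieTree.br y z) → ¬ lt x y → Hall lt (LieTree.br x (LieTree.br y z))

/-- The basis of the Lie algebra of classical mechanics: the generators `A`, `B`, and the Hall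
elements `[x, y]` where `x` and `y` are in the basis and `y` has positive degree. -/
def InBasis (lt : LieTree → LieTree → Prop) : LieTree → Prop
  | LieTree.A => True
  | LieTree.B => True
  | LieTree.br x y => Hall lt (LieTree.br x y) ∧ InBasis lt x ∧ InBasis lt y ∧ 0 < y.degree

/-- An enumeration `U 1 = A, U 2 = B, U 3, ...` of the basis by increasing order, where the
elements of order `n` are the `U i` with `d (n - 1) < i ≤ d n`. The value `U 0` plays no role. -/
structure BasisEnum (lt : LieTree → LieTree → Prop) where
  /-- the enumeration, which starts at the index 1 -/
  U : ℕ → LieTree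
  /-- `d n` is the number of basis elements of order at most `n` -/
  d : ℕ → ℕ
  mem : ∀ i, 1 ≤ i → InBasis lt (U i)
  surj : ∀ t, InBasis lt t → ∃ i, 1 ≤ i ∧ U i = t
  inj : ∀ i j, 1 ≤ i → 1 ≤ j → U i = U j → i = j
  U_one : U 1 = LieTree.A
  U_two : U 2 = LieTree.B
  d_zero : d 0 = 0
  order_iff : ∀ n i, 1 ≤ n → 1 ≤ i → ((U i).order = n ↔ d (n - 1) < i ∧ i ≤ d n)

/-- The subspace `L(A, B; n)` of the Lie algebra of classical mechanics, spanned by the `U i` with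
`1 ≤ i ≤ d n`. -/
def BasisEnum.upTo {lt : LieTree → LieTree → Prop} (E : BasisEnum lt) (n : ℕ) : Submodule ℝ LP :=
  Submodule.span ℝ {z | ∃ i, 1 ≤ i ∧ i ≤ E.d n ∧ z = (E.U i).toLP}

/-! ### Functions on phase space and the Poisson bracket -/

/-- The phase space with `d` degrees of freedom; its points are pairs `(p, q)`. -/
abbrev Phase (d : ℕ) : Type := (Fin d → ℝ) × (Fin d → ℝ)

/-- The partial derivative with respect to `p_i`. -/
def dp {d : ℕ} (i : Fin d) (f : Phase d → ℝ) (x : Phase d) : ℝ :=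
  fderiv ℝ f x (Pi.single i 1, 0)

/-- The partial derivative with respect to `q_i`. -/
def dq {d : ℕ} (i : Fin d) (f : Phase d → ℝ) (x : Phase d) : ℝ :=
  fderiv ℝ f x (0, Pi.single i 1)

/-- The canonical Poisson bracket. -/
def poisson {d : ℕ} (f g : Phase d → ℝ) (x : Phase d) : ℝ :=
  ∑ i, (dq i f x * dp i g x - dp i f x * dq i g x)

/-- The smooth functions on phase space which depend polynomially on `p`, i.e. the polynomials in
`p` whose coefficients are smooth functions of `q`. -/
def polAlg (d : ℕ) : Subalgebra ℝ (Phase d → ℝ) :=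
  Algebra.adjoin ℝ ({f | ∃ g : (Fin d → ℝ) → ℝ, ContDiff ℝ ∞ g ∧ f = fun x => g x.2} ∪
    {f | ∃ i : Fin d, f = fun x => x.1 i})

theorem contDiff_p {d : ℕ} (i : Fin d) : ContDiff ℝ ∞ (fun x : Phase d => x.1 i) := by fun_prop

theorem contDiff_of_mem {d : ℕ} {f : Phase d → ℝ} (hf : f ∈ polAlg d) : ContDiff ℝ ∞ f := by
  induction hf using Algebra.adjoin_induction with
  | mem f hf =>
    rcases hf with ⟨g, hg, rfl⟩ | ⟨i, rfl⟩
    · exact hg.comp contDiff_snd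
    · exact contDiff_p i
  | algebraMap r => exact contDiff_const
  | add f g _ _ hf hg => exact hf.add hg
  | mul f g _ _ hf hg => exact hf.mul hg

theorem differentiable_of_mem {d : ℕ} {f : Phase d → ℝ} (hf : f ∈ polAlg d) :
    Differentiable ℝ f := (contDiff_of_mem hf).differentiable (by simp)

theorem dp_add {d : ℕ} (i : Fin d) {f g : Phase d → ℝ} (hf : f ∈ polAlg d) (hg : g ∈ polAlg d) :
    dp i (f + g) = dp i f + dp i g := by
  funext x
  simp [dp, fderiv_add (differentiable_of_mem hf x) (differentiable_of_mem hg x)]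

theorem dq_add {d : ℕ} (i : Fin d) {f g : Phase d → ℝ} (hf : f ∈ polAlg d) (hg : g ∈ polAlg d) :
    dq i (f + g) = dq i f + dq i g := by
  funext x
  simp [dq, fderiv_add (differentiable_of_mem hf x) (differentiable_of_mem hg x)]

theorem dp_mul {d : ℕ} (i : Fin d) {f g : Phase d → ℝ} (hf : f ∈ polAlg d) (hg : g ∈ polAlg d) :
    dp i (f * g) = dp i f * g + f * dp i g := by
  funext x
  simp [dp, fderiv_mul (differentiable_of_mem hf x) (differentiable_of_mem hg x)]
  ring

theorem dq_mul {d : ℕ} (i : Fin d) {f g : Phase d → ℝ} (hf : f ∈ polAlg d) (hg : g ∈ polAlg d) :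
    dq i (f * g) = dq i f * g + f * dq i g := by
  funext x
  simp [dq, fderiv_mul (differentiable_of_mem hf x) (differentiable_of_mem hg x)]
  ring

theorem dp_smul {d : ℕ} (i : Fin d) (c : ℝ) (f : Phase d → ℝ) :
    dp i (c • f) = c • dp i f := by
  funext x
  simp [dp, fderiv_const_smul_field]

theorem dq_smul {d : ℕ} (i : Fin d) (c : ℝ) (f : Phase d → ℝ) :
    dq i (c • f) = c • dq i f := by
  funext x
  simp [dq, fderiv_const_smul_field]

theorem dp_mem {d : ℕ} (i : Fin d) {f : Phase d → ℝ} (hf : f ∈ polAlg d) : dp i f ∈ polAlg d := by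
  induction hf using Algebra.adjoin_induction with
  | mem f hf =>
    rcases hf with ⟨g, hg, rfl⟩ | ⟨j, rfl⟩
    · have h : dp i (fun x : Phase d => g x.2) = 0 := by
        funext x
        have h1 : HasFDerivAt (fun x : Phase d => g x.2)
            ((fderiv ℝ g x.2).comp (ContinuousLinearMap.snd ℝ _ _)) x :=
          ((hg.differentiable (by simp)) x.2).hasFDerivAt.comp x hasFDerivAt_snd
        simp [dp, h1.fderiv]
      rw [h]
      exact zero_mem _
    · have h : dp i (fun x : Phase d => x.1 j) =
          algebraMap ℝ (Phase d → ℝ) ((Pi.single i 1 : Fin d → ℝ) j) := by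
        funext x
        have h1 : HasFDerivAt (fun x : Phase d => x.1 j)
            ((ContinuousLinearMap.proj (R := ℝ) (φ := fun _ : Fin d => ℝ) j).comp
              (ContinuousLinearMap.fst ℝ (Fin d → ℝ) (Fin d → ℝ))) x :=
          ((ContinuousLinearMap.proj (R := ℝ) (φ := fun _ : Fin d => ℝ) j).comp
            (ContinuousLinearMap.fst ℝ (Fin d → ℝ) (Fin d → ℝ))).hasFDerivAt
        simp [dp, h1.fderiv]
      rw [h]
      exact Subalgebra.algebraMap_mem _ _
  | algebraMap r =>
    have h : dp i (algebraMap ℝ (Phase d → ℝ) r) = 0 := by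
      funext x
      change fderiv ℝ (fun _ : Phase d => r) x _ = 0
      simp
    rw [h]
    exact zero_mem _
  | add f g hf hg h1 h2 => rw [dp_add i hf hg]; exact add_mem h1 h2
  | mul f g hf hg h1 h2 =>
    rw [dp_mul i hf hg]
    exact add_mem (mul_mem h1 hg) (mul_mem hf h2)

theorem dq_mem {d : ℕ} (i : Fin d) {f : Phase d → ℝ} (hf : f ∈ polAlg d) : dq i f ∈ polAlg d := by
  induction hf using Algebra.adjoin_induction with
  | mem f hf =>
    rcases hf with ⟨g, hg, rfl⟩ | ⟨j, rfl⟩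
    · have h : dq i (fun x : Phase d => g x.2) =
          fun x => fderiv ℝ g x.2 (Pi.single i 1) := by
        funext x
        have h1 : HasFDerivAt (fun x : Phase d => g x.2)
            ((fderiv ℝ g x.2).comp (ContinuousLinearMap.snd ℝ _ _)) x :=
          ((hg.differentiable (by simp)) x.2).hasFDerivAt.comp x hasFDerivAt_snd
        simp [dq, h1.fderiv]
      rw [h]
      refine Algebra.subset_adjoin (Or.inl ⟨fun y => fderiv ℝ g y (Pi.single i 1), ?_, rfl⟩)
      exact (hg.fderiv_right (m := ∞) (by simp)).clm_apply contDiff_const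
    · have h : dq i (fun x : Phase d => x.1 j) = 0 := by
        funext x
        have h1 : HasFDerivAt (fun x : Phase d => x.1 j)
            ((ContinuousLinearMap.proj (R := ℝ) (φ := fun _ : Fin d => ℝ) j).comp
              (ContinuousLinearMap.fst ℝ (Fin d → ℝ) (Fin d → ℝ))) x :=
          ((ContinuousLinearMap.proj (R := ℝ) (φ := fun _ : Fin d => ℝ) j).comp
            (ContinuousLinearMap.fst ℝ (Fin d → ℝ) (Fin d → ℝ))).hasFDerivAt
        simp [dq, h1.fderiv]
      rw [h]
      exact zero_mem _
  | algebraMap r =>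
    have h : dq i (algebraMap ℝ (Phase d → ℝ) r) = 0 := by
      funext x
      change fderiv ℝ (fun _ : Phase d => r) x _ = 0
      simp
    rw [h]
    exact zero_mem _
  | add f g hf hg h1 h2 => rw [dq_add i hf hg]; exact add_mem h1 h2
  | mul f g hf hg h1 h2 =>
    rw [dq_mul i hf hg]
    exact add_mem (mul_mem h1 hg) (mul_mem hf h2)

/-- Directional derivatives in fixed directions commute. -/
theorem dir_comm {d : ℕ} {f : Phase d → ℝ} (hf : f ∈ polAlg d) (v w x : Phase d) :
    fderiv ℝ (fun y => fderiv ℝ f y w) x v = fderiv ℝ (fun y => fderiv ℝ f y v) x w := by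
  have hc : ContDiff ℝ ∞ (fderiv ℝ f) := (contDiff_of_mem hf).fderiv_right (by simp)
  have hd : DifferentiableAt ℝ (fderiv ℝ f) x := (hc.differentiable (by simp)) x
  have hs : IsSymmSndFDerivAt ℝ f x :=
    (contDiff_of_mem hf).contDiffAt.isSymmSndFDerivAt (by
      simp only [minSmoothness_of_isRCLikeNormedField]
      exact WithTop.coe_le_coe.mpr (le_top : (2 : ℕ∞) ≤ ⊤))
  have key : ∀ u : Phase d, fderiv ℝ (fun y => fderiv ℝ f y u) x =
      (fderiv ℝ (fderiv ℝ f) x).flip u := by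
    intro u
    have := (hd.hasFDerivAt.clm_apply (hasFDerivAt_const u x)).fderiv
    rw [this]
    ext <;> simp
  rw [key, key]
  exact hs v w

/-- The Jacobi identity for the bracket built from commuting derivations. -/
theorem jacobi_aux {R ι : Type*} [CommRing R] [Fintype ι] (P Q : ι → R → R)
    (Pa : ∀ i x y, P i (x + y) = P i x + P i y) (Pn : ∀ i x, P i (-x) = - P i x)
    (Pm : ∀ i x y, P i (x * y) = P i x * y + x * P i y)
    (Qa : ∀ i x y, Q i (x + y) = Q i x + Q i y) (Qn : ∀ i x, Q i (-x) = - Q i x)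
    (Qm : ∀ i x y, Q i (x * y) = Q i x * y + x * Q i y)
    (PP : ∀ i j x, P i (P j x) = P j (P i x)) (QQ : ∀ i j x, Q i (Q j x) = Q j (Q i x))
    (QP : ∀ i j x, Q i (P j x) = P j (Q i x)) (two : ∀ x : R, x = -x → x = 0) (b : R → R → R)
    (hb : ∀ x y, b x y = ∑ i, (Q i x * P i y - P i x * Q i y)) (x y z : R) :
    b x (b y z) = b (b x y) z + b y (b x z) := by
  have P0 : ∀ i, P i 0 = 0 := fun i => by simpa using Pa i 0 0
  have Q0 : ∀ i, Q i 0 = 0 := fun i => by simpa using Qa i 0 0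
  have Ps : ∀ i (f : ι → R), P i (∑ j, f j) = ∑ j, P i (f j) := fun i f =>
    map_sum (⟨⟨P i, P0 i⟩, Pa i⟩ : R →+ R) f _
  have Qs : ∀ i (f : ι → R), Q i (∑ j, f j) = ∑ j, Q i (f j) := fun i f =>
    map_sum (⟨⟨Q i, Q0 i⟩, Qa i⟩ : R →+ R) f _
  simp only [hb, Ps, Qs, sub_eq_add_neg, Pa, Pn, Pm, Qa, Qn, Qm, QP, Finset.mul_sum,
    Finset.sum_mul, ← Finset.sum_neg_distrib, ← Finset.sum_add_distrib]
  rw [← sub_eq_zero, ← Finset.sum_sub_distrib]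
  simp only [← Finset.sum_sub_distrib]
  set D : ι → ι → R := fun i j => _ with hD
  change ∑ i, ∑ j, D i j = 0
  have h : ∀ i j, D i j = - D j i := by
    intro i j
    simp only [hD]
    rw [PP j i x, PP j i y, PP j i z, QQ j i x, QQ j i y, QQ j i z]
    ring
  apply two
  calc ∑ i, ∑ j, D i j = ∑ i, ∑ j, - D j i :=
        Finset.sum_congr rfl fun i _ => Finset.sum_congr rfl fun j _ => h i j
    _ = - ∑ i, ∑ j, D j i := by simp only [Finset.sum_neg_distrib]
    _ = - ∑ i, ∑ j, D i j := by rw [Finset.sum_comm]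

theorem poisson_mem {d : ℕ} {f g : Phase d → ℝ} (hf : f ∈ polAlg d) (hg : g ∈ polAlg d) :
    poisson f g ∈ polAlg d := by
  have h : poisson f g = ∑ i, (dq i f * dp i g - dp i f * dq i g) := by
    funext x
    simp [poisson, Finset.sum_apply]
  rw [h]
  exact sum_mem fun i _ => sub_mem (mul_mem (dq_mem i hf) (dp_mem i hg))
    (mul_mem (dp_mem i hf) (dq_mem i hg))

theorem poisson_jacobi {d : ℕ} {f g h : Phase d → ℝ} (hf : f ∈ polAlg d) (hg : g ∈ polAlg d)
    (hh : h ∈ polAlg d) :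
    poisson f (poisson g h) = poisson (poisson f g) h + poisson g (poisson f h) := by
  have key := jacobi_aux (R := polAlg d) (ι := Fin d)
    (fun i x => ⟨dp i x.1, dp_mem i x.2⟩) (fun i x => ⟨dq i x.1, dq_mem i x.2⟩)
    (fun i x y => Subtype.ext (dp_add i x.2 y.2))
    (fun i x => Subtype.ext (by
      change dp i (-x.1) = - dp i x.1
      rw [← neg_one_smul ℝ x.1, dp_smul, neg_one_smul]))
    (fun i x y => Subtype.ext (dp_mul i x.2 y.2))
    (fun i x y => Subtype.ext (dq_add i x.2 y.2))
    (fun i x => Subtype.ext (by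
      change dq i (-x.1) = - dq i x.1
      rw [← neg_one_smul ℝ x.1, dq_smul, neg_one_smul]))
    (fun i x y => Subtype.ext (dq_mul i x.2 y.2))
    (fun i j x => Subtype.ext (funext fun y => dir_comm x.2 _ _ y))
    (fun i j x => Subtype.ext (funext fun y => dir_comm x.2 _ _ y))
    (fun i j x => Subtype.ext (funext fun y => dir_comm x.2 _ _ y))
    (fun x hx => Subtype.ext (funext fun y => by
      have : x.1 y = - x.1 y := congrFun (congrArg Subtype.val hx) y
      change x.1 y = 0
      linarith))
    (fun x y => ⟨poisson x.1 y.1, poisson_mem x.2 y.2⟩)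
    (fun x y => Subtype.ext (by
      funext z
      simp [poisson, Finset.sum_apply]))
    ⟨f, hf⟩ ⟨g, hg⟩ ⟨h, hh⟩
  exact congrArg Subtype.val key

/-- The smooth functions on phase space that depend polynomially on `p`, as a Lie algebra under the
Poisson bracket. -/
def CPol (d : ℕ) : Type := Subalgebra.toSubmodule (polAlg d)

namespace CPol

instance (d : ℕ) : AddCommGroup (CPol d) :=
  inferInstanceAs (AddCommGroup (Subalgebra.toSubmodule (polAlg d)))

instance (d : ℕ) : Module ℝ (CPol d) :=
  inferInstanceAs (Module ℝ (Subalgebra.toSubmodule (polAlg d)))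

/-- The underlying function on phase space. -/
def toFun {d : ℕ} (f : CPol d) : Phase d → ℝ := Subtype.val f

theorem mem {d : ℕ} (f : CPol d) : f.toFun ∈ polAlg d := Subtype.property f

theorem ext {d : ℕ} {f g : CPol d} (h : f.toFun = g.toFun) : f = g := Subtype.ext h

/-- An element of `CPol d` from a function on phase space. -/
def mk {d : ℕ} (f : Phase d → ℝ) (hf : f ∈ polAlg d) : CPol d := ⟨f, hf⟩

@[simp] theorem toFun_mk {d : ℕ} (f : Phase d → ℝ) (hf : f ∈ polAlg d) : (mk f hf).toFun = f := rfl

@[simp] theorem toFun_add {d : ℕ} (f g : CPol d) : (f + g).toFun = f.toFun + g.toFun := rfl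

@[simp] theorem toFun_zero {d : ℕ} : (0 : CPol d).toFun = 0 := rfl

@[simp] theorem toFun_smul {d : ℕ} (c : ℝ) (f : CPol d) : (c • f).toFun = c • f.toFun := rfl

instance (d : ℕ) : Bracket (CPol d) (CPol d) :=
  ⟨fun f g => mk (poisson f.toFun g.toFun) (poisson_mem f.mem g.mem)⟩

@[simp] theorem toFun_lie {d : ℕ} (f g : CPol d) : ⁅f, g⁆.toFun = poisson f.toFun g.toFun := rfl

instance (d : ℕ) : LieRing (CPol d) where
  add_lie f g h := ext <| by
    funext x
    simp only [toFun_lie, toFun_add, poisson, dp_add _ f.mem g.mem, dq_add _ f.mem g.mem,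
      Pi.add_apply, ← Finset.sum_add_distrib]
    exact Finset.sum_congr rfl fun i _ => by ring
  lie_add f g h := ext <| by
    funext x
    simp only [toFun_lie, toFun_add, poisson, dp_add _ g.mem h.mem, dq_add _ g.mem h.mem,
      Pi.add_apply, ← Finset.sum_add_distrib]
    exact Finset.sum_congr rfl fun i _ => by ring
  lie_self f := ext <| by
    funext x
    simp only [toFun_lie, toFun_zero, poisson, Pi.zero_apply]
    exact Finset.sum_eq_zero fun i _ => by ring
  leibniz_lie f g h := ext (poisson_jacobi f.mem g.mem h.mem)

instance (d : ℕ) : LieAlgebra ℝ (CPol d) where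
  lie_smul c f g := ext <| by
    funext x
    simp only [toFun_lie, toFun_smul, poisson, dp_smul, dq_smul, Pi.smul_apply, smul_eq_mul,
      Finset.mul_sum]
    exact Finset.sum_congr rfl fun i _ => by ring

end CPol

/-! ### Mechanical systems and the homomorphism `Φ_{T,V}` -/

/-- A smooth mechanical system with `d` degrees of freedom: a kinetic energy
`T(p, q) = (1/2) M(q)(p, p)`, where `M(q)` is a symmetric bilinear form that depends smoothly
on `q`, and a smooth potential energy `V(q)`. -/
structure MechSystem (d : ℕ) where
  /-- the kinetic energy, as a function of `(p, q)` -/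
  T : Phase d → ℝ
  /-- the potential energy, as a function of `q` -/
  V : (Fin d → ℝ) → ℝ
  kinetic : ∃ M : (Fin d → ℝ) → Matrix (Fin d) (Fin d) ℝ,
    (∀ q, (M q).IsSymm) ∧ (∀ i j, ContDiff ℝ ∞ fun q => M q i j) ∧
    ∀ p q, T (p, q) = 1 / 2 * ∑ i, ∑ j, M q i j * p i * p j
  potential : ContDiff ℝ ∞ V

theorem mem_of_q {d : ℕ} {g : (Fin d → ℝ) → ℝ} (hg : ContDiff ℝ ∞ g) :
    (fun x : Phase d => g x.2) ∈ polAlg d := Algebra.subset_adjoin (Or.inl ⟨g, hg, rfl⟩)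

theorem mem_p {d : ℕ} (i : Fin d) : (fun x : Phase d => x.1 i) ∈ polAlg d :=
  Algebra.subset_adjoin (Or.inr ⟨i, rfl⟩)

theorem MechSystem.T_mem {d : ℕ} (S : MechSystem d) : S.T ∈ polAlg d := by
  obtain ⟨M, -, hM, hT⟩ := S.kinetic
  have h : S.T = (1 / 2 : ℝ) • ∑ i, ∑ j, (fun x : Phase d => M x.2 i j) *
      (fun x : Phase d => x.1 i) * (fun x : Phase d => x.1 j) := by
    funext ⟨p, q⟩
    simp [hT, Finset.sum_apply]
  rw [h]
  exact Subalgebra.smul_mem _ (sum_mem fun i _ => sum_mem fun j _ =>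
    mul_mem (mul_mem (mem_of_q (hM i j)) (mem_p i)) (mem_p j)) _

/-- The homomorphism from the free Lie algebra `L(A, B)` that maps `A` to `T` and `B` to `V`. -/
def freeHom {d : ℕ} (S : MechSystem d) : FreeLieAlgebra ℝ Gen →ₗ⁅ℝ⁆ CPol d :=
  FreeLieAlgebra.lift ℝ fun g => match g with
    | Gen.A => CPol.mk S.T S.T_mem
    | Gen.B => CPol.mk (fun x => S.V x.2) (mem_of_q S.potential)

/-- A smooth function that is homogeneous of degree zero in `p` does not depend on `p`. -/
theorem indep_of_homogeneous {d : ℕ} {f : Phase d → ℝ} (hf : f ∈ polAlg d)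
    (h : ∀ (t : ℝ), t ≠ 0 → ∀ p q, f (t • p, q) = f (p, q)) (p q) : f (p, q) = f (0, q) := by
  have hc : Continuous fun t : ℝ => f (t • p, q) :=
    (contDiff_of_mem hf).continuous.comp (by fun_prop)
  have h1 : Filter.Tendsto (fun t : ℝ => f (t • p, q)) (nhdsWithin 0 {0}ᶜ) (nhds (f (0, q))) := by
    have := hc.tendsto 0
    simp only [zero_smul] at this
    exact this.mono_left nhdsWithin_le_nhds
  have h2 : Filter.Tendsto (fun t : ℝ => f (t • p, q)) (nhdsWithin 0 {0}ᶜ) (nhds (f (p, q))) :=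
    tendsto_const_nhds.congr' (by
      filter_upwards [self_mem_nhdsWithin] with t ht
      exact (h t ht p q).symm)
  exact tendsto_nhds_unique h2 h1

theorem dp_eq_zero_of_indep {d : ℕ} {f : Phase d → ℝ} (hf : f ∈ polAlg d)
    (h : ∀ p q, f (p, q) = f (0, q)) (i : Fin d) : dp i f = 0 := by
  funext x
  have hcomp : f = f ∘ (fun y : Phase d => ((0 : Fin d → ℝ), y.2)) := by
    funext ⟨p, q⟩
    exact h p q
  have h2 : HasFDerivAt (fun y : Phase d => ((0 : Fin d → ℝ), y.2))
      ((0 : Phase d →L[ℝ] (Fin d → ℝ)).prod (ContinuousLinearMap.snd ℝ _ _)) x :=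
    (hasFDerivAt_const _ _).prodMk hasFDerivAt_snd
  have h1 := ((differentiable_of_mem hf) (0, x.2)).hasFDerivAt.comp x h2
  rw [← hcomp] at h1
  have h0 : ((0, 0) : Phase d) = 0 := rfl
  simp [dp, h1.fderiv, h0]

theorem dp_scale {d : ℕ} {f : Phase d → ℝ} (hf : f ∈ polAlg d) {n : ℕ} {t : ℝ}
    (h : ∀ p q, f (t • p, q) = t ^ n * f (p, q)) (i : Fin d) (p q) :
    t * dp i f (t • p, q) = t ^ n * dp i f (p, q) ∧ dq i f (t • p, q) = t ^ n * dq i f (p, q) := by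
  have e : f ∘ (fun y : Phase d => (t • y.1, y.2)) = t ^ n • f := by
    funext ⟨p, q⟩
    exact h p q
  have h2 : HasFDerivAt (fun y : Phase d => (t • y.1, y.2))
      ((t • ContinuousLinearMap.fst ℝ (Fin d → ℝ) (Fin d → ℝ)).prod
        (ContinuousLinearMap.snd ℝ _ _)) (p, q) :=
    (hasFDerivAt_fst.const_smul t).prodMk hasFDerivAt_snd
  have h1 := ((differentiable_of_mem hf) (t • p, q)).hasFDerivAt.comp (p, q) h2
  rw [e] at h1
  have h3 := ((differentiable_of_mem hf (p, q)).hasFDerivAt.const_smul (t ^ n)).unique h1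
  constructor
  · have := congrArg (fun L : Phase d →L[ℝ] ℝ => L (Pi.single i 1, 0)) h3
    have h4 : ((t • Pi.single i 1, 0) : Phase d) = t • (Pi.single i 1, 0) := by simp
    simp only [smul_apply, ContinuousLinearMap.comp_apply,
      ContinuousLinearMap.prod_apply, ContinuousLinearMap.coe_fst', ContinuousLinearMap.coe_snd',
      smul_eq_mul, h4, map_smul] at this
    exact this.symm
  · have := congrArg (fun L : Phase d →L[ℝ] ℝ => L (0, Pi.single i 1)) h3
    simp only [smul_apply, ContinuousLinearMap.comp_apply,
      ContinuousLinearMap.prod_apply, ContinuousLinearMap.coe_fst', ContinuousLinearMap.coe_snd',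
      smul_eq_mul, smul_zero] at this
    exact this.symm

/-- If both degrees are zero the bracket vanishes; in general degrees in `p` combine to
`n + m - 1`. -/
theorem poisson_scale {d : ℕ} {f g : Phase d → ℝ} (hf : f ∈ polAlg d) (hg : g ∈ polAlg d)
    {n m : ℕ} (h1 : ∀ t : ℝ, t ≠ 0 → ∀ p q, f (t • p, q) = t ^ n * f (p, q))
    (h2 : ∀ t : ℝ, t ≠ 0 → ∀ p q, g (t • p, q) = t ^ m * g (p, q)) :
    (n = 0 → m = 0 → poisson f g = 0) ∧
    ∀ t : ℝ, t ≠ 0 → ∀ p q, poisson f g (t • p, q) = t ^ (n + m - 1) * poisson f g (p, q) := by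
  have h0 : n = 0 → m = 0 → poisson f g = 0 := by
    rintro rfl rfl
    have hf0 := dp_eq_zero_of_indep hf (indep_of_homogeneous hf (by simpa using h1))
    have hg0 := dp_eq_zero_of_indep hg (indep_of_homogeneous hg (by simpa using h2))
    funext x
    simp [poisson, hf0, hg0]
  refine ⟨h0, fun t ht p q => ?_⟩
  by_cases hnm : n + m = 0
  · rw [h0 (by omega) (by omega)]
    simp
  · obtain ⟨k, hk⟩ : ∃ k, n + m = k + 1 := ⟨n + m - 1, by omega⟩
    have hk' : n + m - 1 = k := by omega
    rw [hk']
    apply mul_left_cancel₀ ht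
    have hpow : t ^ n * t ^ m = t * t ^ k := by rw [← pow_add, hk, pow_succ, mul_comm]
    simp only [poisson, Finset.mul_sum]
    refine Finset.sum_congr rfl fun i _ => ?_
    obtain ⟨a1, a2⟩ := dp_scale hf (h1 t ht) i p q
    obtain ⟨b1, b2⟩ := dp_scale hg (h2 t ht) i p q
    calc t * (dq i f (t • p, q) * dp i g (t • p, q) - dp i f (t • p, q) * dq i g (t • p, q))
        = dq i f (t • p, q) * (t * dp i g (t • p, q)) -
            (t * dp i f (t • p, q)) * dq i g (t • p, q) := by ring
      _ = (t ^ n * t ^ m) *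
            (dq i f (p, q) * dp i g (p, q) - dp i f (p, q) * dq i g (p, q)) := by
          rw [a1, a2, b1, b2]; ring
      _ = _ := by rw [hpow]; ring

/-- A bracket expression of degree `n` is mapped to a function that is homogeneous of degree `n`
in `p`. -/
theorem freeHom_scale {d : ℕ} (S : MechSystem d) (s : LieTree) :
    ∀ t : ℝ, t ≠ 0 → ∀ p q,
      (freeHom S s.eval).toFun (t • p, q) = t ^ s.degree * (freeHom S s.eval).toFun (p, q) := by
  induction s with
  | A =>
    obtain ⟨M, -, -, hT⟩ := S.kinetic
    intro t _ p q
    simp only [freeHom, LieTree.eval, FreeLieAlgebra.lift_of_apply, CPol.toFun_mk, LieTree.degree,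
      hT, Finset.mul_sum, Pi.smul_apply, smul_eq_mul]
    exact Finset.sum_congr rfl fun i _ => Finset.sum_congr rfl fun j _ => by ring
  | B =>
    intro t _ p q
    simp [freeHom, LieTree.eval, LieTree.degree]
  | br x y hx hy =>
    simp only [LieTree.eval, LieHom.map_lie, CPol.toFun_lie, LieTree.degree]
    exact (poisson_scale (CPol.mem _) (CPol.mem _) hx hy).2

theorem freeHom_degreeIdeal {d : ℕ} (S : MechSystem d) : degreeIdeal ≤ (freeHom S).ker := by
  refine LieSubmodule.lieSpan_le.mpr ?_
  rintro z ⟨x, hx, y, hy, rfl⟩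
  have key : ∀ x ∈ degreeSpan 0, ∀ y ∈ degreeSpan 0, freeHom S ⁅x, y⁆ = 0 := by
    intro x hx y hy
    induction hx using Submodule.span_induction with
    | mem x hx =>
      obtain ⟨s, hs, rfl⟩ := hx
      induction hy using Submodule.span_induction with
      | mem y hy =>
        obtain ⟨t, ht, rfl⟩ := hy
        rw [LieHom.map_lie]
        exact CPol.ext ((poisson_scale (CPol.mem _) (CPol.mem _) (freeHom_scale S s)
          (freeHom_scale S t)).1 hs ht)
      | zero => simp
      | add y z _ _ h1 h2 => rw [lie_add, map_add, h1, h2, add_zero]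
      | smul c y _ h => rw [lie_smul, map_smul, h, smul_zero]
    | zero => simp
    | add x z _ _ h1 h2 => rw [add_lie, map_add, h1, h2, add_zero]
    | smul c x _ h => rw [smul_lie, map_smul, h, smul_zero]
  exact LieHom.mem_ker.mpr (key x hx y hy)

/-- The homomorphism `Φ_{T,V}` of Lie algebras from the Lie algebra of classical mechanics to the
smooth functions on phase space that are polynomial in `p`, with `A ↦ T` and `B ↦ V`. -/
def Phi {d : ℕ} (S : MechSystem d) : LP →ₗ⁅ℝ⁆ CPol d :=
  { Submodule.liftQ degreeIdeal.toSubmodule (freeHom S : FreeLieAlgebra ℝ Gen →ₗ[ℝ] CPol d)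
      (fun _ hx => LieHom.mem_ker.mp (freeHom_degreeIdeal S hx)) with
    map_lie' := by
      intro x y
      obtain ⟨x, rfl⟩ := LieSubmodule.Quotient.surjective_mk' degreeIdeal x
      obtain ⟨y, rfl⟩ := LieSubmodule.Quotient.surjective_mk' degreeIdeal y
      exact (freeHom S).map_lie x y }

theorem Phi_A {d : ℕ} (S : MechSystem d) : (Phi S LieTree.A.toLP).toFun = S.T := by
  change (freeHom S (FreeLieAlgebra.of ℝ Gen.A)).toFun = S.T
  simp [freeHom]

theorem Phi_B {d : ℕ} (S : MechSystem d) :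
    (Phi S LieTree.B.toLP).toFun = fun x => S.V x.2 := by
  change (freeHom S (FreeLieAlgebra.of ℝ Gen.B)).toFun = _
  simp [freeHom]

/-! ### The explicit kinetic energies -/

namespace BasisEnum

variable {lt : LieTree → LieTree → Prop} (E : BasisEnum lt)

/-- The index `i ≥ 1` of the basis element `t = U i`. -/
def index (t : LieTree) : ℕ := sInf {i | 1 ≤ i ∧ E.U i = t}

/-- The monomial `W_i` in the variables `p_0, p_1, ...` and `q_0, q_1, ...`, for `i ≥ 3`. The four
cases are, with `U i = [U_{j_m}, ..., [U_{j_1}, A]...]`: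
* `m = 1` and `degree U_{j_1} = 0`: `p_i p_{j_1}`;
* `m ≥ 1` and `degree U_{j_1} > 0`: `p_0 p_i q_{j_1} ... q_{j_m}`;
* `m = 2` and `degree U_{j_1} = degree U_{j_2} = 0`: `q_i p_{j_1} p_{j_2}`;
* `m ≥ 2` and `degree U_{j_1} = 0 < degree U_{j_2}`: `p_i p_{j_1} q_{j_2} ... q_{j_m}`. -/
def W (i : ℕ) (p q : ℕ → ℝ) : ℝ :=
  match (E.U i).factors with
  | [] => 0
  | [x] =>
      if x.degree = 0 then p i * p (E.index x)
      else p 0 * p i * q (E.index x)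
  | x :: y :: l =>
      if x.degree = 0 then
        if y.degree = 0 then q i * p (E.index x) * p (E.index y)
        else p i * p (E.index x) * ((y :: l).map fun z => q (E.index z)).prod
      else p 0 * p i * ((x :: y :: l).map fun z => q (E.index z)).prod

/-- The kinetic energy `p_0 p_1 + ∑ W_i`, where `3 ≤ i ≤ d n`, as a function of
`p = (p_0, ..., p_{d n})` and `q = (q_0, ..., q_{d n})`. (`Fin.ofNat _ j` is the index `j`
if `j ≤ d n`; other indices do not occur.) -/
def kineticEnergy (n : ℕ) (p q : Fin (E.d n + 1) → ℝ) : ℝ :=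
  p 0 * p 1 +
    ∑ i ∈ Finset.Icc 3 (E.d n), E.W i (fun j => p (Fin.ofNat _ j)) (fun j => q (Fin.ofNat _ j))

/-- The potential energy `q_2`. -/
def potentialEnergy (n : ℕ) (q : Fin (E.d n + 1) → ℝ) : ℝ := q 2

end BasisEnum

end

end MechLie

/-!
The functions `Φ(t)` of the mechanical systems below are linear in one half of the canonical
variables. In each conjugate pair `p_i, q_i` with `i ≥ 1` let the head variable `h_i` be `q_i` if
`U_i` has degree zero and `p_i` otherwise, and let `f_i` be the other variable. If
`U_i = [x_m, ..., [x_1, A]...]`, then the degrees that can occur in the basis show that `W_i` is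
`h_i` times the product of the variables `f` of the factors `x_1, ..., x_m`, up to the variable
`p_0`, which behaves like a constant because nothing depends on `q_0`. So `V = h_2`, and `T` is
linear in `h`; the Poisson bracket preserves linearity in `h` and becomes, up to signs, the Lie
bracket of polynomial vector fields in the variables `f` (`poisson_fieldFun`,
`BasisEnum.Phi_system`). The vector fields of `T` and `V` are those by which Grossman and Larson
realize free nilpotent Lie algebras.

The key fact is `BasisEnum.normalForm`, a form of Lazard elimination. For `z = [a, y]` in the basis
and `c ≥ a`, restrict the vector field of `z` to the subspace where `f_u = 0` for all `u < c` (and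
`p_0 = 1`). The component with index `l` is then a nonzero multiple of the product of the variables
of `β` if `U_l` arises from `z` by successive brackets with a list `β` of elements `≥ c`, and zero
otherwise. The induction step is short: on the subspace for `a` itself the field of `a` is a
multiple of `∂/∂f_a`, because no basis element has the form `[x, a]` with `x ≥ a`; hence bracketing
with `a` is differentiation with respect to `f_a`, which removes one factor `a`. For `c = z` only
the component of `z` is left, so at `f = 0` the field of `U_j` is a nonzero multiple of `∂/∂f_j`
(`BasisEnum.eval_field_ne_zero_iff`), and this is the first property of the systems. It provides
functionals dual to `U_1, ..., U_{d n}` that vanish on the kernel of `Φ`, whence the second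
property, the linear independence of the basis, and the statement on the intersection of all
kernels.

That the basis spans follows from the rewriting procedure of P. Hall (`lie_mem_spanAbove`); the Hall
elements which are left out are brackets of elements of degree zero. In particular the freeness of
the Hall basis in the free Lie algebra is not needed. The enumeration is constructed by counting the
basis elements that precede a given one.
-/

namespace MechLie

/-! ### Bracket expressions and Hall orders -/

namespace LieTree

theorem order_pos (t : LieTree) : 0 < t.order := by
  induction t with
  | A => simp [order]
  | B => simp [order]
  | br x y hx hy => simp only [order]; omega

/-- The right-nested bracket `[x_m, ..., [x_1, z]...]` for the list `[x_1, ..., x_m]`. -/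
def nest (z : LieTree) (l : List LieTree) : LieTree := l.foldl (fun y x => br x y) z

@[simp] theorem nest_nil (z : LieTree) : nest z [] = z := rfl

@[simp] theorem nest_cons (z x : LieTree) (l : List LieTree) :
    nest z (x :: l) = nest (br x z) l := rfl

@[simp] theorem nest_append_singleton (z x : LieTree) (l : List LieTree) :
    nest z (l ++ [x]) = br x (nest z l) := by simp [nest]

theorem factors_nest (z : LieTree) (l : List LieTree) :
    (nest z l).factors = z.factors ++ l := by
  induction l generalizing z with
  | nil => simp
  | cons x l ih => simp [ih, factors]

theorem order_lt_of_mem_factors {x t : LieTree} (h : x ∈ t.factors) : x.order < t.order := by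
  induction t with
  | A => simp [factors] at h
  | B => simp [factors] at h
  | br w y _ hy =>
    simp only [factors, List.mem_append, List.mem_singleton] at h
    have := w.order_pos
    have := y.order_pos
    simp only [order]
    rcases h with h | rfl
    · have := hy h
      omega
    · omega

end LieTree

open LieTree

variable {lt : LieTree → LieTree → Prop}

namespace IsHallOrder

theorem irrefl (h : IsHallOrder lt) (x : LieTree) : ¬ lt x x :=
  haveI := h.strictTotal
  _root_.irrefl_of lt x

theorem trans (h : IsHallOrder lt) {x y z : LieTree} (h1 : lt x y) (h2 : lt y z) : lt x z :=
  haveI := h.strictTotal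
  _root_.trans_of lt h1 h2

theorem asymm (h : IsHallOrder lt) {x y : LieTree} (h1 : lt x y) : ¬ lt y x := fun h2 =>
  h.irrefl x (h.trans h1 h2)

theorem trichotomy (h : IsHallOrder lt) (x y : LieTree) : lt x y ∨ x = y ∨ lt y x :=
  haveI := h.strictTotal
  trichotomous_of lt x y

theorem le_trans (h : IsHallOrder lt) {x y z : LieTree} (h1 : ¬ lt y x) (h2 : ¬ lt z y) :
    ¬ lt z x := fun h3 => by
  rcases h.trichotomy x y with h4 | rfl | h4
  · exact h2 (h.trans h3 h4)
  · exact h2 h3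
  · exact h1 h4

theorem degree_le (h : IsHallOrder lt) {x y : LieTree} (hxy : ¬ lt y x) :
    x.degree ≤ y.degree := by
  by_contra! hd
  exact hxy (h.of_degree_lt _ _ hd)

/-- A bracket is larger than its left factor, as in every generalized Hall order. -/
theorem lt_br (h : IsHallOrder lt) {x y : LieTree} (hxy : lt x y) : lt x (br x y) := by
  have hd := h.degree_le (h.asymm hxy)
  have hy := y.order_pos
  rcases Nat.lt_or_ge x.degree (x.degree + y.degree - 1) with hlt | hge
  · exact h.of_degree_lt _ _ hlt
  · refine h.of_order_lt _ _ ?_ ?_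
    · simp only [degree]
      omega
    · simp only [order]
      omega

theorem not_lt_B (h : IsHallOrder lt) (x : LieTree) : ¬ lt x B := by
  intro hx
  have hd : x.degree = 0 := by simpa [degree] using h.degree_le (h.asymm hx)
  match x with
  | A => simp [degree] at hd
  | B => exact h.irrefl _ hx
  | br y z =>
    refine h.asymm hx (h.of_order_lt _ _ (by rw [hd]; rfl) ?_)
    have := y.order_pos
    have := z.order_pos
    simp only [order]
    omega

end IsHallOrder

theorem Hall.lt_of_br {x y : LieTree} (h : Hall lt (br x y)) : lt x y := by
  cases h <;> assumption

theorem Hall.not_lt_of_br_br {x y z : LieTree} (h : Hall lt (br x (br y z))) : ¬ lt x y := by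
  cases h; assumption

theorem InBasis.hall {t : LieTree} (h : InBasis lt t) : Hall lt t := by
  cases t with
  | A => exact .A
  | B => exact .B
  | br x y => exact h.1

theorem InBasis.of_nest {z : LieTree} {l : List LieTree} (h : InBasis lt (nest z l)) :
    InBasis lt z := by
  induction l generalizing z with
  | nil => exact h
  | cons x l ih => exact (ih h).2.2.1

theorem InBasis.not_lt_of_br {x y a b : LieTree} (h : InBasis lt (br x y)) (hy : y = br a b) :
    ¬ lt x a := by
  subst hy
  exact h.1.not_lt_of_br_br

theorem InBasis.of_mem_factors {x t : LieTree} (h : InBasis lt t) (hx : x ∈ t.factors) :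
    InBasis lt x := by
  induction t with
  | A => simp [factors] at hx
  | B => simp [factors] at hx
  | br w y _ hy =>
    simp only [factors, List.mem_append, List.mem_singleton] at hx
    rcases hx with hx | rfl
    · exact hy h.2.2.1 hx
    · exact h.2.1

theorem InBasis.nest_B {l : List LieTree} (h : InBasis lt (nest B l)) : l = [] := by
  cases l with
  | nil => rfl
  | cons x l => exact absurd (InBasis.of_nest (l := l) h).2.2.2 (by simp [degree])

theorem InBasis.eq_nest {t : LieTree} (h : InBasis lt t) (hB : t ≠ B) : t = nest A t.factors := by
  induction t with
  | A => rfl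
  | B => exact absurd rfl hB
  | br x y _ hy =>
    have hy' := hy h.2.2.1 (by rintro rfl; simpa [degree] using h.2.2.2)
    rw [factors, nest_append_singleton, ← hy']

/-- The factors of a basis element are listed in nondecreasing order. -/
theorem InBasis.factors_pairwise (ho : IsHallOrder lt) {t : LieTree} (h : InBasis lt t) :
    t.factors.Pairwise fun x y => ¬ lt y x := by
  induction t with
  | A => simp [factors]
  | B => simp [factors]
  | br x y _ hy =>
    have hy' := hy h.2.2.1
    rw [factors, List.pairwise_append]
    refine ⟨hy', by simp, ?_⟩
    intro a ha b hb
    rw [List.mem_singleton] at hb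
    subst hb
    cases y with
    | A => simp [factors] at ha
    | B => simp [factors] at ha
    | br u v =>
      have hu := h.not_lt_of_br rfl
      rw [factors, List.mem_append, List.mem_singleton] at ha
      rcases ha with ha | rfl
      · rw [factors, List.pairwise_append] at hy'
        exact ho.le_trans (hy'.2.2 a ha u (by simp)) hu
      · exact hu

/-- The possible degrees of the factors of a basis element other than `A` and `B`. -/
theorem InBasis.factors_cases (ho : IsHallOrder lt) {t : LieTree} (h : InBasis lt t)
    (hA : t ≠ A) (hB : t ≠ B) : ∃ x l, t.factors = x :: l ∧
      ((x.degree = 0 ∧ l = [] ∧ t.degree = 1) ∨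
      (x.degree = 0 ∧ t.degree = 0 ∧ ∃ y, y.degree = 0 ∧ l = [y]) ∨
      (x.degree = 0 ∧ t.degree = 1 ∧ l ≠ [] ∧ ∀ y ∈ l, 0 < y.degree) ∨
      (0 < x.degree ∧ 2 ≤ t.degree ∧ ∀ y ∈ l, 0 < y.degree)) := by
  induction t with
  | A => exact absurd rfl hA
  | B => exact absurd rfl hB
  | br w s _ ih =>
    have hd := h.2.2.2
    have hws := ho.degree_le (ho.asymm h.1.lt_of_br)
    cases s with
    | A =>
      refine ⟨w, [], rfl, ?_⟩
      rcases Nat.eq_zero_or_pos w.degree with h0 | h0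
      · exact Or.inl ⟨h0, rfl, by simp [degree, h0]⟩
      · exact Or.inr (Or.inr (Or.inr ⟨h0, by simp only [degree]; omega, by simp⟩))
    | B => simp [degree] at hd
    | br u v =>
      obtain ⟨x, l, hl, hc⟩ := ih h.2.2.1 (by simp) (by simp)
      have huw := ho.degree_le (h.not_lt_of_br rfl)
      have hdeg : (br w (br u v)).degree = w.degree + (br u v).degree - 1 := rfl
      have hu : u ∈ x :: l := by rw [← hl]; simp [factors]
      refine ⟨x, l ++ [w], by rw [factors, hl]; rfl, ?_⟩
      rcases hc with ⟨h1, rfl, h3⟩ | ⟨h1, h2, -⟩ | ⟨h1, h2, h3, h4⟩ | ⟨h1, h2, h3⟩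
      · rcases Nat.eq_zero_or_pos w.degree with h0 | h0
        · exact Or.inr (Or.inl ⟨h1, by omega, w, h0, rfl⟩)
        · exact Or.inr (Or.inr (Or.inl ⟨h1, by omega, by simp, by simpa using h0⟩))
      · omega
      · have hl' := (List.eq_nil_or_concat l).resolve_left h3
        have hul : 0 < u.degree := by
          obtain ⟨l', y, rfl⟩ := hl'
          rw [factors, List.concat_eq_append, ← List.cons_append] at hl
          have := (List.append_inj' hl rfl).2
          simp only [List.cons.injEq, and_true] at this
          exact h4 u (by simp [this])
        refine Or.inr (Or.inr (Or.inl ⟨h1, by omega, by simp, ?_⟩))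
        intro y hy
        rcases List.mem_append.mp hy with hy | hy
        · exact h4 y hy
        · rw [List.mem_singleton.mp hy]; omega
      · have hul : 0 < u.degree := by
          rcases List.mem_cons.mp hu with rfl | hu
          · exact h1
          · exact h3 u hu
        refine Or.inr (Or.inr (Or.inr ⟨h1, by omega, ?_⟩))
        intro y hy
        rcases List.mem_append.mp hy with hy | hy
        · exact h3 y hy
        · rw [List.mem_singleton.mp hy]; omega

theorem finite_order_le (n : ℕ) : {t : LieTree | t.order ≤ n}.Finite := by
  induction n with
  | zero =>
    convert Set.finite_empty
    ext t
    have := t.order_pos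
    simp only [Set.mem_ofPred_eq, Set.mem_empty_iff_false, iff_false]
    omega
  | succ n ih =>
    refine ((Set.toFinite {A, B}).union (Set.Finite.image2 br ih ih)).subset ?_
    intro t ht
    cases t with
    | A => simp
    | B => simp
    | br x y =>
      have := x.order_pos
      have := y.order_pos
      simp only [Set.mem_ofPred_eq, order] at ht
      exact Or.inr ⟨x, by simp only [Set.mem_ofPred_eq]; omega, y,
        by simp only [Set.mem_ofPred_eq]; omega, rfl⟩

/-! ### The basis spans the Lie algebra of classical mechanics -/

@[simp] theorem LieTree.toLP_br (x y : LieTree) : (br x y).toLP = ⁅x.toLP, y.toLP⁆ := rfl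

theorem lie_toLP_eq_zero {x y : LieTree} (hx : x.degree = 0) (hy : y.degree = 0) :
    ⁅x.toLP, y.toLP⁆ = 0 := by
  rw [← toLP_br]
  refine (LieSubmodule.Quotient.mk_eq_zero' (N := degreeIdeal)).mpr ?_
  exact LieSubmodule.subset_lieSpan ⟨x.eval, Submodule.subset_span ⟨x, hx, rfl⟩,
    y.eval, Submodule.subset_span ⟨y, hy, rfl⟩, rfl⟩

/-- The span of the basis elements of order `n` that are larger than `c`. -/
noncomputable def spanAbove (lt : LieTree → LieTree → Prop) (n : ℕ) (c : LieTree) : Submodule ℝ LP :=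
  Submodule.span ℝ {z | ∃ t, InBasis lt t ∧ t.order = n ∧ lt c t ∧ z = t.toLP}

/-- The rewriting procedure of P. Hall: `[x, [y, z]] = [[x, y], z] + [y, [x, z]]` is applied as long
as `x < y`. Each step produces brackets of the same order whose smaller entry is larger than `x`,
so the procedure stops. The Hall elements outside the basis that turn up are brackets of two
elements of degree zero. -/
theorem lie_mem_spanAbove (ho : IsHallOrder lt) (n k : ℕ) (x y : LieTree) (hx : InBasis lt x)
    (hy : InBasis lt y) (hn : x.order + y.order = n)
    (hk : {t | t.order ≤ n ∧ lt x t}.ncard = k) (hxy : lt x y) :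
    ⁅x.toLP, y.toLP⁆ ∈ spanAbove lt n x := by
  induction n using Nat.strong_induction_on generalizing k x y with
  | _ n ihn =>
  induction k using Nat.strong_induction_on generalizing x y with
  | _ k ihk =>
  have hall : Hall lt (br x y) → ⁅x.toLP, y.toLP⁆ ∈ spanAbove lt n x := by
    intro h
    rcases Nat.eq_zero_or_pos y.degree with h0 | h0
    · have := ho.degree_le (ho.asymm hxy)
      rw [lie_toLP_eq_zero (by omega) h0]
      exact zero_mem _
    · exact Submodule.subset_span ⟨br x y, ⟨h, hx, hy, h0⟩, hn, ho.lt_br hxy, rfl⟩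
  cases y with
  | A => exact hall (.brA x hx.hall hxy)
  | B => exact absurd hxy (ho.not_lt_B x)
  | br y z =>
    by_cases hxy1 : lt x y
    swap
    · exact hall (.brbr x y z hx.hall hy.hall hxy hxy1)
    have hyz := hy.1.lt_of_br
    have hxz := ho.trans hxy1 hyz
    have px := x.order_pos
    have py := y.order_pos
    have pz := z.order_pos
    simp only [order] at hn
    have pair : ∀ u v, InBasis lt u → InBasis lt v → u.order + v.order = n → lt x u → lt u v →
        ⁅u.toLP, v.toLP⁆ ∈ spanAbove lt n x := by
      intro u v hu hv huv hxu h
      have hlt : {t | t.order ≤ n ∧ lt u t}.ncard < k := by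
        rw [← hk]
        refine Set.ncard_lt_ncard ⟨fun t ht => ⟨ht.1, ho.trans hxu ht.2⟩, fun hs => ?_⟩
          ((finite_order_le n).subset fun t ht => ht.1)
        exact ho.irrefl u (hs (⟨by omega, hxu⟩ : u ∈ {t | t.order ≤ n ∧ lt x t})).2
      refine Submodule.span_mono ?_ (ihk _ hlt u v hu hv huv rfl h)
      rintro w ⟨t, h1, h2, h3, rfl⟩
      exact ⟨t, h1, h2, ho.trans hxu h3, rfl⟩
    have pair' : ∀ u v, InBasis lt u → InBasis lt v → u.order + v.order = n → lt x u → lt x v →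
        ⁅u.toLP, v.toLP⁆ ∈ spanAbove lt n x := by
      intro u v hu hv huv hxu hxv
      rcases ho.trichotomy u v with h | rfl | h
      · exact pair u v hu hv huv hxu h
      · rw [lie_self]
        exact zero_mem _
      · rw [← lie_skew]
        exact neg_mem (pair v u hv hu (by omega) hxv h)
    have left : ∀ m, ∀ w ∈ spanAbove lt m x, ∀ v, InBasis lt v → m + v.order = n → lt x v →
        ⁅w, v.toLP⁆ ∈ spanAbove lt n x := by
      intro m w hw v hv hm hxv
      induction hw using Submodule.span_induction with
      | mem w hw =>
        obtain ⟨t, h1, h2, h3, rfl⟩ := hw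
        exact pair' t v h1 hv (by omega) h3 hxv
      | zero => simp
      | add a b _ _ h1 h2 => rw [add_lie]; exact add_mem h1 h2
      | smul c a _ h => rw [smul_lie]; exact Submodule.smul_mem _ _ h
    rw [toLP_br, leibniz_lie]
    refine add_mem ?_ ?_
    · exact left _ _ (ihn (x.order + y.order) (by omega) _ x y hx hy.2.1 rfl rfl hxy1) z hy.2.2.1
        (by omega) hxz
    · rw [← lie_skew]
      exact neg_mem (left _ _ (ihn (x.order + z.order) (by omega) _ x z hx hy.2.2.1 rfl rfl hxz) y
        hy.2.1 (by omega) hxy1)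

theorem lie_mem_span_toLP (ho : IsHallOrder lt) {x y : LieTree} (hx : InBasis lt x)
    (hy : InBasis lt y) :
    ⁅x.toLP, y.toLP⁆ ∈ Submodule.span ℝ (LieTree.toLP '' {t | InBasis lt t}) := by
  have key : ∀ x y, InBasis lt x → InBasis lt y → lt x y →
      ⁅x.toLP, y.toLP⁆ ∈ Submodule.span ℝ (LieTree.toLP '' {t | InBasis lt t}) := by
    intro x y hx hy hxy
    refine Submodule.span_mono ?_ (lie_mem_spanAbove ho _ _ x y hx hy rfl rfl hxy)
    rintro w ⟨t, h1, -, -, rfl⟩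
    exact ⟨t, h1, rfl⟩
  rcases ho.trichotomy x y with h | rfl | h
  · exact key x y hx hy h
  · rw [lie_self]
    exact zero_mem _
  · rw [← lie_skew]
    exact neg_mem (key y x hy hx h)

theorem span_toLP_eq_top (ho : IsHallOrder lt) :
    Submodule.span ℝ (LieTree.toLP '' {t | InBasis lt t}) = ⊤ := by
  let K : LieSubalgebra ℝ LP :=
    { Submodule.span ℝ (LieTree.toLP '' {t | InBasis lt t}) with
      lie_mem' := by
        intro x y hx hy
        simp only [AddSubsemigroup.mem_carrier, AddSubmonoid.mem_toSubsemigroup,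
          Submodule.mem_toAddSubmonoid] at hx hy ⊢
        induction hx using Submodule.span_induction with
        | mem x hx =>
          obtain ⟨s, hs, rfl⟩ := hx
          induction hy using Submodule.span_induction with
          | mem y hy =>
            obtain ⟨t, ht, rfl⟩ := hy
            exact lie_mem_span_toLP ho hs ht
          | zero => simp
          | add a b _ _ h1 h2 => rw [lie_add]; exact add_mem h1 h2
          | smul c a _ h => rw [lie_smul]; exact Submodule.smul_mem _ _ h
        | zero => simp
        | add a b _ _ h1 h2 => rw [add_lie]; exact add_mem h1 h2
        | smul c a _ h => rw [smul_lie]; exact Submodule.smul_mem _ _ h }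
  let π : FreeLieAlgebra ℝ Gen →ₗ⁅ℝ⁆ LP :=
    { (LieSubmodule.Quotient.mk' degreeIdeal : FreeLieAlgebra ℝ Gen →ₗ[ℝ] LP) with
      map_lie' := rfl }
  have hA : A.toLP ∈ K := Submodule.subset_span ⟨A, trivial, rfl⟩
  have hB : B.toLP ∈ K := Submodule.subset_span ⟨B, trivial, rfl⟩
  let φ : FreeLieAlgebra ℝ Gen →ₗ⁅ℝ⁆ K := FreeLieAlgebra.lift ℝ fun g => match g with
    | Gen.A => ⟨A.toLP, hA⟩
    | Gen.B => ⟨B.toLP, hB⟩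
  have hφ : K.incl.comp φ = π := by
    apply FreeLieAlgebra.hom_ext
    rintro (_ | _)
    · change ((φ (FreeLieAlgebra.of ℝ Gen.A) : K) : LP) = A.toLP
      simp [φ]
    · change ((φ (FreeLieAlgebra.of ℝ Gen.B) : K) : LP) = B.toLP
      simp [φ]
  rw [eq_top_iff]
  intro x _
  obtain ⟨y, rfl⟩ := LieSubmodule.Quotient.surjective_mk' degreeIdeal x
  have : π y ∈ K := by
    rw [← hφ]
    exact (φ y).2
  exact this

end MechLie

namespace MechLie

open MvPolynomial

/-! ### Functions on phase space that come from polynomial vector fields -/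

theorem hasFDerivAt_eval {d : ℕ} (P : MvPolynomial (Fin d) ℝ) (f : Fin d → ℝ) :
    HasFDerivAt (fun f : Fin d → ℝ => eval f P)
      (∑ j, eval f (pderiv j P) • ContinuousLinearMap.proj (R := ℝ) (φ := fun _ : Fin d => ℝ) j)
      f := by
  induction P using MvPolynomial.induction_on with
  | C a => simpa using hasFDerivAt_const a f
  | add P Q hP hQ =>
    simp only [map_add, add_smul, Finset.sum_add_distrib]
    exact hP.add hQ
  | mul_X P i hP =>
    simp only [map_mul, eval_X]
    have hi : HasFDerivAt (fun f : Fin d → ℝ => f i)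
        (ContinuousLinearMap.proj (R := ℝ) (φ := fun _ : Fin d => ℝ) i) f :=
      (ContinuousLinearMap.proj (R := ℝ) (φ := fun _ : Fin d => ℝ) i).hasFDerivAt
    refine (hP.mul hi).congr_fderiv ?_
    ext v
    simp only [pderiv_mul, pderiv_X, map_add, map_mul, eval_X, add_smul, Finset.sum_add_distrib,
      add_apply, sum_apply, smul_apply,
      ContinuousLinearMap.proj_apply, smul_eq_mul, Finset.mul_sum]
    rw [add_comm]
    congr 1
    · exact Finset.sum_congr rfl fun j _ => by ring
    · rw [Finset.sum_eq_single i]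
      · simp
      · intro j _ hj
        simp [Pi.single_eq_of_ne' hj]
      · simp

variable {d : ℕ} (Z : Fin d → Prop) [DecidablePred Z]

/-- One variable `h_i` of each conjugate pair `p_i, q_i`: it is `q_i` if `Z i`, and `p_i`
otherwise. -/
def headVar : Phase d →ₗ[ℝ] (Fin d → ℝ) where
  toFun x i := if Z i then x.2 i else x.1 i
  map_add' x y := by ext i; simp only [Prod.fst_add, Prod.snd_add, Pi.add_apply]; split_ifs <;> rfl
  map_smul' c x := by
    ext i
    simp only [Prod.smul_fst, Prod.smul_snd, Pi.smul_apply, RingHom.id_apply]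
    split_ifs <;> rfl

/-- The variable `f_i` which is conjugate to `headVar Z i`. -/
def baseVar : Phase d →ₗ[ℝ] (Fin d → ℝ) := headVar fun i => ¬ Z i

/-- The function `∑ h_i X_i(f)` that corresponds to a polynomial vector field `∑ X_i ∂/∂f_i`, where
`h = headVar Z` and `f = baseVar Z`. -/
noncomputable def fieldFun (X : Fin d → MvPolynomial (Fin d) ℝ) (x : Phase d) : ℝ :=
  ∑ k, headVar Z x k * eval (baseVar Z x) (X k)

/-- The operation on polynomial vector fields that corresponds to the Poisson bracket, see
`poisson_fieldFun`: the Lie bracket, twisted by the sign of the `i`-th canonical pair `h_i, f_i`. -/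
noncomputable def fieldBracket (X Y : Fin d → MvPolynomial (Fin d) ℝ) (l : Fin d) :
    MvPolynomial (Fin d) ℝ :=
  ∑ k, C (if Z k then 1 else -1) * (X k * pderiv k (Y l) - Y k * pderiv k (X l))

theorem fderiv_fieldFun (X : Fin d → MvPolynomial (Fin d) ℝ) (x v : Phase d) :
    fderiv ℝ (fieldFun Z X) x v = ∑ k, (headVar Z v k * eval (baseVar Z x) (X k) +
      headVar Z x k * ∑ j, eval (baseVar Z x) (pderiv j (X k)) * baseVar Z v j) := by
  have hh : ∀ k, HasFDerivAt (fun y : Phase d => headVar Z y k)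
      ((ContinuousLinearMap.proj (R := ℝ) (φ := fun _ : Fin d => ℝ) k).comp
        (headVar Z).toContinuousLinearMap) x := fun k =>
    ((ContinuousLinearMap.proj (R := ℝ) (φ := fun _ : Fin d => ℝ) k).comp
        (headVar Z).toContinuousLinearMap).hasFDerivAt
  have hf : HasFDerivAt (fun y : Phase d => baseVar Z y) (baseVar Z).toContinuousLinearMap x :=
    (baseVar Z).toContinuousLinearMap.hasFDerivAt
  have key := HasFDerivAt.fun_sum (u := Finset.univ) fun k _ =>
    (hh k).mul ((hasFDerivAt_eval (X k) (baseVar Z x)).comp x hf)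
  rw [show fderiv ℝ (fieldFun Z X) x = _ from key.fderiv]
  simp only [sum_apply, add_apply, smul_apply, ContinuousLinearMap.comp_apply,
    ContinuousLinearMap.proj_apply, smul_eq_mul, LinearMap.coe_toContinuousLinearMap',
    Function.comp_apply]
  exact Finset.sum_congr rfl fun k _ => by ring

theorem fderiv_fieldFun_of_head (X : Fin d → MvPolynomial (Fin d) ℝ) (x v : Phase d) (i : Fin d)
    (hh : headVar Z v = Pi.single i 1) (hf : baseVar Z v = 0) :
    fderiv ℝ (fieldFun Z X) x v = eval (baseVar Z x) (X i) := by
  simp [fderiv_fieldFun, hh, hf, Pi.single_apply]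

theorem fderiv_fieldFun_of_base (X : Fin d → MvPolynomial (Fin d) ℝ) (x v : Phase d) (i : Fin d)
    (hh : headVar Z v = 0) (hf : baseVar Z v = Pi.single i 1) :
    fderiv ℝ (fieldFun Z X) x v =
      ∑ k, headVar Z x k * eval (baseVar Z x) (pderiv i (X k)) := by
  simp [fderiv_fieldFun, hh, hf, Pi.single_apply]

theorem headVar_single_p (i : Fin d) :
    headVar Z (Pi.single i 1, 0) = if Z i then 0 else Pi.single i 1 := by
  ext k
  by_cases hk : k = i
  · subst hk
    by_cases h : Z k <;> simp [headVar, h]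
  · by_cases h : Z i <;> simp [headVar, h, hk]

theorem headVar_single_q (i : Fin d) :
    headVar Z (0, Pi.single i 1) = if Z i then Pi.single i 1 else 0 := by
  ext k
  by_cases hk : k = i
  · subst hk
    by_cases h : Z k <;> simp [headVar, h]
  · by_cases h : Z i <;> simp [headVar, h, hk]

theorem dp_fieldFun (X : Fin d → MvPolynomial (Fin d) ℝ) (x : Phase d) (i : Fin d) :
    dp i (fieldFun Z X) x = if Z i then ∑ k, headVar Z x k * eval (baseVar Z x) (pderiv i (X k))
      else eval (baseVar Z x) (X i) := by
  split_ifs with h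
  · exact fderiv_fieldFun_of_base Z X x _ i (by simp [headVar_single_p, h])
      (by simp [baseVar, headVar_single_p, h])
  · exact fderiv_fieldFun_of_head Z X x _ i (by simp [headVar_single_p, h])
      (by simp [baseVar, headVar_single_p, h])

theorem dq_fieldFun (X : Fin d → MvPolynomial (Fin d) ℝ) (x : Phase d) (i : Fin d) :
    dq i (fieldFun Z X) x = if Z i then eval (baseVar Z x) (X i)
      else ∑ k, headVar Z x k * eval (baseVar Z x) (pderiv i (X k)) := by
  split_ifs with h
  · exact fderiv_fieldFun_of_head Z X x _ i (by simp [headVar_single_q, h])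
      (by simp [baseVar, headVar_single_q, h])
  · exact fderiv_fieldFun_of_base Z X x _ i (by simp [headVar_single_q, h])
      (by simp [baseVar, headVar_single_q, h])

theorem poisson_fieldFun (X Y : Fin d → MvPolynomial (Fin d) ℝ) :
    poisson (fieldFun Z X) (fieldFun Z Y) = fieldFun Z (fieldBracket Z X Y) := by
  funext x
  simp only [poisson, dp_fieldFun, dq_fieldFun]
  simp only [fieldFun, fieldBracket, map_sum, map_mul, map_sub, eval_C, Finset.mul_sum]
  rw [Finset.sum_comm]
  refine Finset.sum_congr rfl fun i _ => ?_
  split_ifs <;>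
  · simp only [Finset.mul_sum, Finset.sum_mul, ← Finset.sum_sub_distrib]
    exact Finset.sum_congr rfl fun k _ => by ring

/-! ### Restriction of polynomials to a coordinate subspace -/

/-- The restriction of polynomials to the subspace where `f_0 = 1` and where `f_i = 0` for the
indices `i ≠ 0` in `K`. -/
noncomputable def restrict {N : ℕ} (K : Fin (N + 1) → Prop) [DecidablePred K] :
    MvPolynomial (Fin (N + 1)) ℝ →ₐ[ℝ] MvPolynomial (Fin (N + 1)) ℝ :=
  aeval fun i => if i = 0 then 1 else if K i then 0 else X i

/-- Derivatives in directions tangent to the subspace commute with the restriction to it. -/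
theorem restrict_pderiv {N : ℕ} (K : Fin (N + 1) → Prop) [DecidablePred K] {k : Fin (N + 1)}
    (hk : k ≠ 0) (hK : ¬ K k) (P : MvPolynomial (Fin (N + 1)) ℝ) :
    restrict K (pderiv k P) = pderiv k (restrict K P) := by
  induction P using MvPolynomial.induction_on with
  | C a => simp [restrict, algebraMap_eq]
  | add P Q hP hQ => simp [hP, hQ]
  | mul_X P i hP =>
    have hX : restrict K (pderiv k (X i)) = pderiv k (restrict K (X i)) := by
      by_cases hi : i = k
      · subst hi
        simp [restrict, hk, hK]
      · rw [pderiv_X_of_ne hi, map_zero, restrict, aeval_X]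
        split_ifs
        · exact pderiv_one.symm
        · simp
        · exact (pderiv_X_of_ne hi).symm
    rw [pderiv_mul, map_add, map_mul, map_mul, map_mul, pderiv_mul, hP, hX]

theorem restrict_restrict {N : ℕ} {K K' : Fin (N + 1) → Prop} [DecidablePred K]
    [DecidablePred K'] (h : ∀ i, K i → K' i) (P : MvPolynomial (Fin (N + 1)) ℝ) :
    restrict K' (restrict K P) = restrict K' P := by
  induction P using MvPolynomial.induction_on with
  | C a => simp [restrict, algebraMap_eq]
  | add P Q hP hQ => simp [hP, hQ]
  | mul_X P i hP =>
    rw [map_mul, map_mul, map_mul, hP]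
    congr 1
    by_cases h0 : i = 0
    · simp [restrict, h0]
    · by_cases hi : K i
      · simp [restrict, h0, hi, h i hi]
      · simp [restrict, h0, hi]

theorem eval_restrict {N : ℕ} (K : Fin (N + 1) → Prop) [DecidablePred K]
    (P : MvPolynomial (Fin (N + 1)) ℝ) :
    eval 0 (restrict K P) = eval (Pi.single 0 1) P := by
  induction P using MvPolynomial.induction_on with
  | C a => simp [restrict, algebraMap_eq]
  | add P Q hP hQ => rw [map_add, map_add, map_add, hP, hQ]
  | mul_X P i hP =>
    rw [map_mul, map_mul, map_mul, hP]
    congr 1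
    by_cases h0 : i = 0
    · simp [restrict, h0]
    · by_cases hi : K i
      · simp [restrict, h0, hi]
      · simp [restrict, h0, hi]

end MechLie

namespace MechLie

open MvPolynomial LieTree

variable {lt : LieTree → LieTree → Prop}

/-! ### Orders and indices of the basis elements -/

/-- The brackets `[A, ..., [A, [[B, A], A]]...]` belong to the basis. -/
theorem exists_inBasis_of_order (ho : IsHallOrder lt) (n : ℕ) :
    ∃ t, InBasis lt t ∧ t.order = n + 1 := by
  have hBA : lt B A := ho.of_degree_lt _ _ (by simp [degree])
  have h2 : InBasis lt (br B A) := ⟨.brA B .B hBA, trivial, trivial, by simp [degree]⟩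
  have key : ∀ k, ∃ t, InBasis lt t ∧ t.order = k + 3 ∧ 0 < t.degree ∧ lt A t ∧
      ∃ a b, t = br a b ∧ ¬ lt A a := by
    intro k
    induction k with
    | zero =>
      have h3 : lt (br B A) A := ho.of_degree_lt _ _ (by simp [degree])
      refine ⟨br (br B A) A, ⟨.brA _ h2.hall h3, h2, trivial, by simp [degree]⟩, rfl,
        by simp [degree], ho.of_order_lt _ _ rfl (by simp [order]), _, _, rfl, ho.asymm h3⟩
    | succ k ih =>
      obtain ⟨_, h1, h3, h4, h5, a, b, rfl, h6⟩ := ih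
      refine ⟨br A (br a b), ⟨.brbr _ _ _ .A h1.hall h5 h6, trivial, h1, h4⟩, ?_, ?_, ho.lt_br h5,
        _, _, rfl, ho.irrefl A⟩
      · rw [order, h3, order]
        omega
      · rw [degree, degree]
        omega
  match n with
  | 0 => exact ⟨A, trivial, rfl⟩
  | 1 => exact ⟨br B A, h2, rfl⟩
  | k + 2 =>
    obtain ⟨t, h1, h3, -⟩ := key k
    exact ⟨t, h1, h3⟩

namespace BasisEnum

variable (E : BasisEnum lt)

theorem order_le {n i : ℕ} (hi : 1 ≤ i) (h : i ≤ E.d n) : (E.U i).order ≤ n := by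
  induction n with
  | zero => rw [E.d_zero] at h; omega
  | succ n ih =>
    by_cases hn : i ≤ E.d n
    · exact (ih hn).trans n.le_succ
    · exact ((E.order_iff (n + 1) i (by omega) hi).mpr ⟨by simpa using hn, h⟩).le

theorem d_mono (ho : IsHallOrder lt) : Monotone E.d := by
  refine monotone_nat_of_le_succ fun n => ?_
  obtain ⟨t, ht, hn⟩ := exists_inBasis_of_order ho n
  obtain ⟨i, hi, rfl⟩ := E.surj t ht
  have := (E.order_iff (n + 1) i (by omega) hi).mp hn
  simp only [Nat.add_sub_cancel] at this
  omega

theorem le_d (ho : IsHallOrder lt) {n i : ℕ} (hi : 1 ≤ i) (h : (E.U i).order ≤ n) : i ≤ E.d n :=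
  ((E.order_iff _ i (E.U i).order_pos hi).mp rfl).2.trans (E.d_mono ho h)

theorem index_spec {t : LieTree} (ht : InBasis lt t) : 1 ≤ E.index t ∧ E.U (E.index t) = t :=
  Nat.sInf_mem (s := {i | 1 ≤ i ∧ E.U i = t}) (E.surj t ht)

/-- The index of a basis element, as the index of a coordinate. -/
noncomputable def pos (n : ℕ) (t : LieTree) : Fin (E.d n + 1) := Fin.ofNat _ (E.index t)

variable {n : ℕ}

theorem one_le_of_ne_zero {N : ℕ} {i : Fin (N + 1)} (hi : i ≠ 0) : 1 ≤ (i : ℕ) :=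
  Nat.one_le_iff_ne_zero.mpr fun h => hi (Fin.ext h)

theorem inBasis {i : Fin (E.d n + 1)} (hi : i ≠ 0) : InBasis lt (E.U i) :=
  E.mem i (one_le_of_ne_zero hi)

theorem order_le_of_ne_zero {i : Fin (E.d n + 1)} (hi : i ≠ 0) : (E.U i).order ≤ n :=
  E.order_le (one_le_of_ne_zero hi) (Nat.lt_succ_iff.mp i.2)

theorem eq_of_U_eq {i j : Fin (E.d n + 1)} (hi : i ≠ 0) (hj : j ≠ 0) (h : E.U i = E.U j) :
    i = j :=
  Fin.ext (E.inj i j (one_le_of_ne_zero hi) (one_le_of_ne_zero hj) h)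

theorem val_pos (ho : IsHallOrder lt) {t : LieTree} (ht : InBasis lt t) (hn : t.order ≤ n) :
    (E.pos n t : ℕ) = E.index t := by
  have h := E.index_spec ht
  have := E.le_d ho h.1 (h.2.symm ▸ hn)
  rw [pos, Fin.val_ofNat, Nat.mod_eq_of_lt (by omega)]

theorem pos_ne_zero (ho : IsHallOrder lt) {t : LieTree} (ht : InBasis lt t) (hn : t.order ≤ n) :
    E.pos n t ≠ 0 := by
  intro h
  have h1 := E.val_pos ho ht hn
  rw [h] at h1
  have := (E.index_spec ht).1
  simp only [Fin.val_zero] at h1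
  omega

theorem U_pos (ho : IsHallOrder lt) {t : LieTree} (ht : InBasis lt t) (hn : t.order ≤ n) :
    E.U (E.pos n t) = t := by
  rw [E.val_pos ho ht hn, (E.index_spec ht).2]

/-! ### The vector fields of the bracket expressions -/

open scoped Classical in
/-- The vector field of the kinetic energy: its component at the index `l ≥ 1` of a basis element
other than `B` is the product of the variables of the factors of that element, and of the variable
with index `0` if none of the factors has degree zero. -/
noncomputable def fieldA (n : ℕ) (l : Fin (E.d n + 1)) : MvPolynomial (Fin (E.d n + 1)) ℝ :=
  if l = 0 ∨ E.U l = B then 0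
  else (if ∃ x ∈ (E.U l).factors, x.degree = 0 then 1 else X 0) *
    ((E.U l).factors.map fun x => X (E.pos n x)).prod

open scoped Classical in
/-- The constant vector field of the potential energy. -/
noncomputable def fieldB (n : ℕ) (l : Fin (E.d n + 1)) : MvPolynomial (Fin (E.d n + 1)) ℝ :=
  if l ≠ 0 ∧ E.U l = B then 1 else 0

/-- The coordinates for which `q` is the head variable: those of the basis elements of degree zero,
and the auxiliary coordinate with index `0`. -/
def HeadQ (n : ℕ) (i : Fin (E.d n + 1)) : Prop := i = 0 ∨ (E.U i).degree = 0

open scoped Classical in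
/-- The vector field of a bracket expression. -/
noncomputable def field (n : ℕ) : LieTree → Fin (E.d n + 1) → MvPolynomial (Fin (E.d n + 1)) ℝ
  | A => E.fieldA n
  | B => E.fieldB n
  | br x y => fieldBracket (E.HeadQ n) (field n x) (field n y)

/-- The exponent of the product of the variables of the basis elements in a list. -/
noncomputable def expo (n : ℕ) (l : List LieTree) : Fin (E.d n + 1) →₀ ℕ :=
  (l.map fun x => Finsupp.single (E.pos n x) 1).sum

open scoped Classical in
/-- The restriction to the subspace where the variables of the basis elements smaller than `c`
vanish and the variable with index `0` is `1`. -/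
noncomputable abbrev res (n : ℕ) (c : LieTree) :
    MvPolynomial (Fin (E.d n + 1)) ℝ →ₐ[ℝ] MvPolynomial (Fin (E.d n + 1)) ℝ :=
  restrict fun i => lt (E.U i) c

theorem monomial_expo (l : List LieTree) (κ : ℝ) :
    monomial (E.expo n l) κ = C κ * (l.map fun x => X (E.pos n x)).prod := by
  induction l with
  | nil => simp [expo]
  | cons x l ih =>
    have : E.expo n (x :: l) = Finsupp.single (E.pos n x) 1 + E.expo n l := by simp [expo]
    rw [this, ← one_mul κ, ← monomial_mul, ih, List.map_cons, List.prod_cons, X, one_mul]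
    ring

theorem res_prod (ho : IsHallOrder lt) {c : LieTree} {l : List LieTree}
    (hl : ∀ x ∈ l, InBasis lt x ∧ x.order ≤ n) :
    ((∀ x ∈ l, ¬ lt x c) → E.res n c (l.map fun x => X (E.pos n x)).prod =
      (l.map fun x => X (E.pos n x)).prod) ∧
    ((∃ x ∈ l, lt x c) → E.res n c (l.map fun x => X (E.pos n x)).prod = 0) := by
  classical
  have hX : ∀ x ∈ l, E.res n c (X (E.pos n x)) = if lt x c then 0 else X (E.pos n x) := by
    intro x hx
    obtain ⟨h1, h2⟩ := hl x hx
    simp only [res, restrict, aeval_X, E.pos_ne_zero ho h1 h2, E.U_pos ho h1 h2, if_false]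
  rw [map_list_prod, List.map_map]
  constructor
  · intro h
    congr 1
    exact List.map_congr_left fun x hx => by
      rw [Function.comp_apply, hX x hx, if_neg (h x hx)]
  · rintro ⟨x, hx, hc⟩
    refine List.prod_eq_zero (List.mem_map.mpr ⟨x, hx, ?_⟩)
    rw [Function.comp_apply, hX x hx, if_pos hc]

theorem res_monomial (ho : IsHallOrder lt) {c : LieTree} {l : List LieTree} (κ : ℝ)
    (hl : ∀ x ∈ l, InBasis lt x ∧ x.order ≤ n) :
    ((∀ x ∈ l, ¬ lt x c) → E.res n c (monomial (E.expo n l) κ) = monomial (E.expo n l) κ) ∧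
    ((∃ x ∈ l, lt x c) → E.res n c (monomial (E.expo n l) κ) = 0) := by
  have hC : E.res n c (C κ) = C κ := by simp [restrict, algebraMap_eq]
  rw [monomial_expo, map_mul, hC]
  exact ⟨fun h => by rw [(E.res_prod ho hl).1 h], fun h => by
    rw [(E.res_prod ho hl).2 h, mul_zero]⟩

/-- The element with index `l` arises from `z` by brackets with the elements of the list `β`, none
of which is smaller than `c`. -/
def Extends (n : ℕ) (c z : LieTree) (l : Fin (E.d n + 1)) (β : List LieTree) : Prop :=
  l ≠ 0 ∧ E.U l = nest z β ∧ ∀ x ∈ β, ¬ lt x c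

theorem Extends.mem {E : BasisEnum lt} {c z : LieTree} {l : Fin (E.d n + 1)} {β : List LieTree}
    (h : E.Extends n c z l β) {x : LieTree} (hx : x ∈ β) : InBasis lt x ∧ x.order ≤ n := by
  have hx' : x ∈ (E.U l).factors := by
    rw [h.2.1, factors_nest]
    exact List.mem_append_right _ hx
  exact ⟨(E.inBasis h.1).of_mem_factors hx',
    (order_lt_of_mem_factors hx').le.trans (E.order_le_of_ne_zero h.1)⟩

/-- The restriction of the vector field of `z` to the subspace where the variables of the basis
elements smaller than `c` vanish has as its `l`-th component a nonzero multiple of the product of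
the variables of `β` if the element with index `l` arises from `z` by brackets with elements
`β ≥ c`, and zero if there is no such list. -/
def NormalForm (n : ℕ) (c z : LieTree) : Prop :=
  ∀ l : Fin (E.d n + 1),
    (∀ β, E.Extends n c z l β →
      ∃ κ : ℝ, κ ≠ 0 ∧ E.res n c (E.field n z l) = monomial (E.expo n β) κ) ∧
    ((∀ β, ¬ E.Extends n c z l β) → E.res n c (E.field n z l) = 0)

theorem normalForm_A (ho : IsHallOrder lt) (c : LieTree) : E.NormalForm n c A := by
  intro l
  have hprod : l ≠ 0 → E.U l ≠ B → E.res n c (E.field n A l) =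
      E.res n c ((E.U l).factors.map fun x => X (E.pos n x)).prod := by
    intro h0 hB
    simp only [field, fieldA]
    rw [if_neg (by tauto), map_mul]
    split_ifs
    · simp
    · simp [restrict]
  have hmem : l ≠ 0 → ∀ x ∈ (E.U l).factors, InBasis lt x ∧ x.order ≤ n := fun h0 x hx =>
    ⟨(E.inBasis h0).of_mem_factors hx,
      (order_lt_of_mem_factors hx).le.trans (E.order_le_of_ne_zero h0)⟩
  constructor
  · rintro β ⟨h0, hβ, hc⟩
    have hf : (E.U l).factors = β := by rw [hβ, factors_nest]; rfl
    have hB : E.U l ≠ B := by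
      intro h
      rw [h] at hβ hf
      rw [← hf] at hβ
      simp [factors] at hβ
    refine ⟨1, one_ne_zero, ?_⟩
    rw [hprod h0 hB, (E.res_prod ho (hmem h0)).1 (hf ▸ hc), hf, monomial_expo]
    simp
  · intro h
    by_cases h0 : l = 0
    · simp [field, fieldA, h0]
    by_cases hB : E.U l = B
    · simp [field, fieldA, hB]
    rw [hprod h0 hB]
    refine (E.res_prod ho (hmem h0)).2 ?_
    by_contra! hc
    exact h _ ⟨h0, (E.inBasis h0).eq_nest hB, hc⟩

theorem normalForm_B (c : LieTree) : E.NormalForm n c B := by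
  intro l
  constructor
  · rintro β ⟨h0, hβ, -⟩
    have hb := E.inBasis h0
    rw [hβ] at hb
    have := hb.nest_B
    subst this
    refine ⟨1, one_ne_zero, ?_⟩
    rw [field, fieldB, if_pos ⟨h0, hβ⟩, map_one]
    simp [expo]
  · intro h
    rw [field, fieldB, if_neg, map_zero]
    rintro ⟨h0, hB⟩
    exact h [] ⟨h0, hB, by simp⟩

theorem ne_zero_of_res_field_ne_zero {c z : LieTree} (hz : E.NormalForm n c z)
    (ho : IsHallOrder lt) (hcz : ¬ lt z c) {k : Fin (E.d n + 1)}
    (hk : E.res n c (E.field n z k) ≠ 0) : k ≠ 0 ∧ ¬ lt (E.U k) c := by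
  have : ∃ β, E.Extends n c z k β := by
    by_contra! h
    exact hk ((hz k).2 h)
  obtain ⟨β, h0, hβ, hc⟩ := this
  refine ⟨h0, ?_⟩
  rcases List.eq_nil_or_concat β with rfl | ⟨β, x, rfl⟩
  · rw [hβ]
    exact hcz
  · intro h
    have hb := E.inBasis h0
    rw [List.concat_eq_append, nest_append_singleton] at hβ
    rw [hβ] at h hb
    exact hc x (by simp) (ho.trans (ho.lt_br hb.1.lt_of_br) h)

/-- On the subspace where the smaller variables vanish, the vector field of `a` is a multiple of the
derivation with respect to the variable of `a`. -/
theorem res_field_self {a : LieTree} (ho : IsHallOrder lt) (ha : InBasis lt a)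
    (hn : a.order ≤ n) (h : E.NormalForm n a a) : ∃ κ : ℝ, κ ≠ 0 ∧
      ∀ k, E.res n a (E.field n a k) = if k = E.pos n a then C κ else 0 := by
  have hnil : ∀ k β, E.Extends n a a k β → β = [] ∧ k = E.pos n a := by
    rintro k β ⟨h0, hβ, hc⟩
    have hb := E.inBasis h0
    have : β = [] := by
      cases β with
      | nil => rfl
      | cons x β =>
        rw [hβ, nest_cons] at hb
        exact absurd hb.of_nest.1.lt_of_br (hc x (by simp))
    subst this
    exact ⟨rfl, E.eq_of_U_eq h0 (E.pos_ne_zero ho ha hn) (by rw [E.U_pos ho ha hn, hβ, nest_nil])⟩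
  obtain ⟨κ, hκ, h1⟩ := (h (E.pos n a)).1 []
    ⟨E.pos_ne_zero ho ha hn, E.U_pos ho ha hn, by simp⟩
  refine ⟨κ, hκ, fun k => ?_⟩
  split_ifs with hk
  · subst hk
    rw [h1]
    simp [expo]
  · exact (h k).2 fun β hβ => hk (hnil k β hβ).2

/-- On the subspace where the variables smaller than that of `a` vanish, bracketing with `a` is a
multiple of the partial derivative with respect to the variable of `a`. -/
theorem res_field_br {a y : LieTree} (ho : IsHallOrder lt) (ha : InBasis lt a)
    (hn : a.order ≤ n) (haa : E.NormalForm n a a) (hay : E.NormalForm n a y) (hlt : lt a y) :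
    ∃ κ : ℝ, κ ≠ 0 ∧ ∀ l, E.res n a (E.field n (br a y) l) =
      C κ * pderiv (E.pos n a) (E.res n a (E.field n y l)) := by
  classical
  obtain ⟨κ, hκ, hself⟩ := E.res_field_self ho ha hn haa
  refine ⟨(if E.HeadQ n (E.pos n a) then 1 else -1) * κ, by split_ifs <;> simpa, fun l => ?_⟩
  have h2 : ∀ k, E.res n a (E.field n y k) * E.res n a (pderiv k (E.field n a l)) = 0 := by
    intro k
    by_cases hk : E.res n a (E.field n y k) = 0
    · rw [hk, zero_mul]
    · obtain ⟨h0, hc⟩ := E.ne_zero_of_res_field_ne_zero hay ho (ho.asymm hlt) hk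
      rw [restrict_pderiv _ h0 hc, hself]
      split_ifs <;> simp
  have h1 : ∀ k, E.res n a (E.field n a k) * E.res n a (pderiv k (E.field n y l)) =
      if k = E.pos n a then C κ * pderiv (E.pos n a) (E.res n a (E.field n y l)) else 0 := by
    intro k
    rw [hself]
    split_ifs with hk
    · subst hk
      rw [restrict_pderiv _ (E.pos_ne_zero ho ha hn)]
      rw [E.U_pos ho ha hn]
      exact ho.irrefl a
    · rw [zero_mul]
  simp only [field, fieldBracket, map_sum, map_mul, map_sub, h1, h2, sub_zero, mul_ite, mul_zero,
    Finset.sum_ite_eq', Finset.mem_univ, if_true]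
  split_ifs <;> simp [restrict]

theorem expo_apply_eq_zero (ho : IsHallOrder lt) {a : LieTree} (ha : InBasis lt a)
    (hn : a.order ≤ n) {β : List LieTree} (hβ : ∀ x ∈ β, InBasis lt x ∧ x.order ≤ n)
    (h : a ∉ β) : E.expo n β (E.pos n a) = 0 := by
  induction β with
  | nil => simp [expo]
  | cons x β ih =>
    have hx : E.pos n x ≠ E.pos n a := by
      intro he
      obtain ⟨h1, h2⟩ := hβ x (by simp)
      have := E.U_pos ho h1 h2
      rw [he, E.U_pos ho ha hn] at this
      exact h (by simp [this])
    have := ih (fun y hy => hβ y (by simp [hy])) fun hy => h (by simp [hy])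
    simp only [expo, List.map_cons, List.sum_cons, Finsupp.add_apply] at this ⊢
    rw [this, Finsupp.single_eq_of_ne hx.symm]

/-- The vector field of a basis element `z = [a, y]`, restricted to the subspace where the variables
smaller than that of `c ≥ a` vanish, is a linear combination, with nonzero coefficients, of the same
monomial fields that occur for a generator, with `z` in place of the generator. -/
theorem normalForm (ho : IsHallOrder lt) (z : LieTree) (hz : InBasis lt z) (hn : z.order ≤ n)
    (c : LieTree) (hc : ∀ a y, z = br a y → ¬ lt c a) : E.NormalForm n c z := by
  classical
  induction z generalizing c with
  | A => exact E.normalForm_A ho c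
  | B => exact E.normalForm_B c
  | br a y iha ihy =>
    have hca : ¬ lt c a := hc a y rfl
    have ha := hz.2.1
    have hlt := hz.1.lt_of_br
    simp only [order] at hn
    have hna : a.order ≤ n := by omega
    have haa := iha ha hna a fun b w hb => by
      subst hb
      exact ho.asymm (ho.lt_br ha.1.lt_of_br)
    have hay := ihy hz.2.2.1 (by omega) a fun b w hb => hz.not_lt_of_br hb
    obtain ⟨κ, hκ, hbr⟩ := E.res_field_br ho ha hna haa hay hlt
    have hres : ∀ l, E.res n c (E.field n (br a y) l) =
        E.res n c (C κ * pderiv (E.pos n a) (E.res n a (E.field n y l))) := by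
      intro l
      rw [← hbr, restrict_restrict]
      intro i hi
      by_contra hci
      exact ho.le_trans hca hci hi
    -- the derivative with respect to the variable of `a` removes one factor `a`
    have hder : ∀ l β, E.Extends n a y l (a :: β) → ∃ κ' : ℝ, κ' ≠ 0 ∧
        C κ * pderiv (E.pos n a) (E.res n a (E.field n y l)) = monomial (E.expo n β) κ' := by
      intro l β h
      obtain ⟨μ, hμ, h1⟩ := (hay l).1 _ h
      have he : E.expo n (a :: β) = E.expo n β + Finsupp.single (E.pos n a) 1 := by
        simp [expo, add_comm]
      rw [h1, pderiv_monomial, C_mul_monomial, he, add_tsub_cancel_right]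
      refine ⟨_, mul_ne_zero hκ (mul_ne_zero hμ ?_), rfl⟩
      simp only [Finsupp.add_apply, Finsupp.single_eq_same]
      positivity
    intro l
    constructor
    · rintro β ⟨h0, hβ, hβc⟩
      have hext : E.Extends n a y l (a :: β) := by
        refine ⟨h0, hβ, fun x hx => ?_⟩
        rcases List.mem_cons.mp hx with rfl | hx
        · exact ho.irrefl _
        · exact ho.le_trans hca (hβc x hx)
      obtain ⟨κ', hκ', h1⟩ := hder l β hext
      refine ⟨κ', hκ', ?_⟩
      rw [hres, h1, (E.res_monomial ho κ' fun x hx => hext.mem (by simp [hx])).1 hβc]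
    · intro hno
      rw [hres]
      by_cases hex : ∃ β, E.Extends n a y l β
      swap
      · rw [(hay l).2 (not_exists.mp hex)]
        simp
      obtain ⟨β, hext⟩ := hex
      by_cases haβ : a ∈ β
      · -- the factors are sorted, so the factor `a` is the first one
        have hβ : ∃ γ, β = a :: γ := by
          cases β with
          | nil => simp at haβ
          | cons x γ =>
            refine ⟨γ, ?_⟩
            congr 1
            have hs := (E.inBasis hext.1).factors_pairwise ho
            rw [hext.2.1, factors_nest, List.pairwise_append] at hs
            rcases List.mem_cons.mp haβ with h | h
            · exact h.symm
            · have h1 := (List.pairwise_cons.mp hs.2.1).1 a h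
              have h2 := hext.2.2 x (by simp)
              rcases ho.trichotomy x a with h3 | h3 | h3
              · exact absurd h3 h2
              · exact h3
              · exact absurd h3 h1
        obtain ⟨γ, rfl⟩ := hβ
        obtain ⟨κ', -, h1⟩ := hder l γ hext
        rw [h1]
        refine (E.res_monomial ho κ' fun x hx => hext.mem (by simp [hx])).2 ?_
        by_contra! hγ
        exact hno γ ⟨hext.1, hext.2.1, hγ⟩
      · obtain ⟨μ, -, h1⟩ := (hay l).1 _ hext
        rw [h1, pderiv_monomial, E.expo_apply_eq_zero ho ha hna (fun x hx => hext.mem hx) haβ]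
        simp

/-- At the point `f = (1, 0, ..., 0)` the vector field of the `j`-th basis element is a nonzero
multiple of the `j`-th coordinate field. -/
theorem eval_field_ne_zero_iff (ho : IsHallOrder lt) {i j : Fin (E.d n + 1)} (hj : j ≠ 0) :
    eval (Pi.single 0 1) (E.field n (E.U j) i) ≠ 0 ↔ i = j := by
  have hb := E.inBasis hj
  have hn := E.order_le_of_ne_zero hj
  have hpos : E.pos n (E.U j) = j :=
    E.eq_of_U_eq (E.pos_ne_zero ho hb hn) hj (E.U_pos ho hb hn)
  have h := E.normalForm ho (E.U j) hb hn (E.U j) fun a y h => by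
    rw [h] at hb ⊢
    exact ho.asymm (ho.lt_br hb.1.lt_of_br)
  obtain ⟨κ, hκ, hself⟩ := E.res_field_self ho hb hn h
  classical
  rw [← eval_restrict fun k => lt (E.U k) (E.U j)]
  have := hself i
  rw [hpos] at this
  rw [res] at this
  convert_to eval 0 (if i = j then C κ else 0 : MvPolynomial (Fin (E.d n + 1)) ℝ) ≠ 0 ↔ i = j
  · rw [← this]
  split_ifs with hij <;> simp [hij, hκ]

/-! ### The mechanical systems -/

theorem two_le_d (ho : IsHallOrder lt) (hn : 1 ≤ n) : 2 ≤ E.d n :=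
  E.le_d ho (by omega) (by rw [E.U_two]; simpa [order] using hn)

theorem headQ_pos (ho : IsHallOrder lt) {t : LieTree} (ht : InBasis lt t) (hn : t.order ≤ n) :
    E.HeadQ n (E.pos n t) ↔ t.degree = 0 := by
  rw [HeadQ, E.U_pos ho ht hn, or_iff_right (E.pos_ne_zero ho ht hn)]

open scoped Classical in
theorem W_eq (ho : IsHallOrder lt) (l : Fin (E.d n + 1)) (hl : 3 ≤ (l : ℕ))
    (p q : Fin (E.d n + 1) → ℝ) :
    E.W l (fun j => p (Fin.ofNat _ j)) (fun j => q (Fin.ofNat _ j)) =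
      headVar (E.HeadQ n) (p, q) l * eval (baseVar (E.HeadQ n) (p, q)) (E.fieldA n l) := by
  have h0 : l ≠ 0 := by
    rintro rfl
    simp at hl
  have hb := E.inBasis h0
  have hA : E.U l ≠ A := fun h => by
    have := E.inj l 1 (by omega) le_rfl (h.trans E.U_one.symm)
    omega
  have hB : E.U l ≠ B := fun h => by
    have := E.inj l 2 (by omega) (by omega) (h.trans E.U_two.symm)
    omega
  have hbase : ∀ x ∈ (E.U l).factors, baseVar (E.HeadQ n) (p, q) (E.pos n x) =
      if x.degree = 0 then p (Fin.ofNat _ (E.index x)) else q (Fin.ofNat _ (E.index x)) := by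
    intro x hx
    have h := E.headQ_pos (n := n) ho (hb.of_mem_factors hx)
      ((order_lt_of_mem_factors hx).le.trans (E.order_le_of_ne_zero h0))
    simp only [baseVar, headVar, LinearMap.coe_mk, AddHom.coe_mk]
    by_cases hd : x.degree = 0
    · rw [if_pos hd, if_neg (not_not.mpr (h.mpr hd))]
      rfl
    · rw [if_neg hd, if_pos (h.not.mpr hd)]
      rfl
  have hbase0 : baseVar (E.HeadQ n) (p, q) 0 = p 0 := by simp [baseVar, headVar, HeadQ]
  have hhead : headVar (E.HeadQ n) (p, q) l = if (E.U l).degree = 0 then q l else p l := by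
    simp [headVar, HeadQ, h0]
  have hpl : Fin.ofNat (E.d n + 1) (l : ℕ) = l := by simp
  have hp0 : Fin.ofNat (E.d n + 1) 0 = 0 := rfl
  have hprod : ∀ L : List LieTree, (∀ y ∈ L, y ∈ (E.U l).factors ∧ 0 < y.degree) →
      L.map ((fun z => eval (baseVar (E.HeadQ n) (p, q)) z) ∘ fun x => X (E.pos n x)) =
      L.map fun z => q (Fin.ofNat _ (E.index z)) := by
    intro L hL
    refine List.map_congr_left fun y hy => ?_
    rw [Function.comp_apply, eval_X, hbase y (hL y hy).1, if_neg (hL y hy).2.ne']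
  obtain ⟨x, L, hf, hc⟩ := hb.factors_cases ho hA hB
  rw [fieldA, if_neg (not_or.mpr ⟨h0, hB⟩), map_mul, map_list_prod, List.map_map, W, hhead]
  rw [hf] at hbase hprod ⊢
  have hx := hbase x (by simp)
  rw [List.map_cons, List.prod_cons, Function.comp_apply, eval_X, hx]
  have hzero : x.degree = 0 → ∃ y ∈ x :: L, y.degree = 0 := fun h => ⟨x, by simp, h⟩
  rcases hc with ⟨h1, rfl, h3⟩ | ⟨h1, h2, y, hy, rfl⟩ | ⟨h1, h2, h3, h4⟩ | ⟨h1, h2, h3⟩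
  · simp only [h1, h3, hpl, if_pos (hzero h1)]
    simp
  · have hy' := hbase y (by simp)
    simp only [h1, h2, hy, hpl, if_pos (hzero h1)]
    simp [hy', hy]
    ring
  · rw [hprod L fun y hy => ⟨by simp [hy], h4 y hy⟩]
    obtain ⟨y, L, rfl⟩ := List.exists_cons_of_ne_nil h3
    have hy := (h4 y (by simp)).ne'
    simp only [h1, h2, hy, hpl, if_pos (hzero h1)]
    simp
    ring
  · rw [hprod L fun y hy => ⟨by simp [hy], h3 y hy⟩]
    have hno : ¬ ∃ y ∈ x :: L, y.degree = 0 := by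
      rintro ⟨y, hy, hy0⟩
      rcases List.mem_cons.mp hy with rfl | hy
      · omega
      · have := h3 y hy
        omega
    rw [if_neg hno, if_neg (by omega), if_neg h1.ne', eval_X, hbase0]
    cases L with
    | nil =>
      simp only [hpl, hp0, if_neg h1.ne']
      simp
      ring
    | cons y L =>
      simp only [hpl, hp0, if_neg h1.ne', List.map_cons, List.prod_cons]
      ring

open scoped Classical in
theorem fieldFun_A (ho : IsHallOrder lt) (hn : 1 ≤ n) (x : Phase (E.d n + 1)) :
    fieldFun (E.HeadQ n) (E.field n A) x = E.kineticEnergy n x.1 x.2 := by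
  obtain ⟨p, q⟩ := x
  have hd := E.two_le_d ho hn
  have v1 : ((1 : Fin (E.d n + 1)) : ℕ) = 1 := by
    rw [Fin.val_one']
    exact Nat.mod_eq_of_lt (by omega)
  let G : ℕ → ℝ := fun i => if i = 0 ∨ i = 2 then 0 else if i = 1 then p 0 * p 1
    else E.W i (fun j => p (Fin.ofNat _ j)) (fun j => q (Fin.ofNat _ j))
  have hG : ∀ k : Fin (E.d n + 1), headVar (E.HeadQ n) (p, q) k *
      eval (baseVar (E.HeadQ n) (p, q)) (E.fieldA n k) = G k := by
    intro k
    by_cases h0 : k = 0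
    · simp [G, h0, fieldA]
    have hk0 : (k : ℕ) ≠ 0 := fun h => h0 (Fin.ext h)
    by_cases h1 : (k : ℕ) = 1
    · have hk : k = 1 := Fin.ext (h1.trans v1.symm)
      have hpk : p k = p 1 := by rw [hk]
      simp [G, fieldA, headVar, baseVar, HeadQ, h0, h1, E.U_one, degree, factors, hpk, mul_comm]
    by_cases h2 : (k : ℕ) = 2
    · simp [G, fieldA, h2, E.U_two]
    · rw [← E.W_eq ho k (by omega)]
      simp [G, hk0, h1, h2]
  simp only [fieldFun, field, hG, kineticEnergy]
  rw [Fin.sum_univ_eq_sum_range G, ← Finset.sum_range_add_sum_Ico G (show 3 ≤ E.d n + 1 by omega)]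
  congr 1
  · simp [Finset.sum_range_succ, G]
  · refine Finset.sum_congr (by ext; simp) fun i hi => ?_
    have := (Finset.mem_Icc.mp hi).1
    simp only [G]
    rw [if_neg (by omega), if_neg (by omega)]

open scoped Classical in
theorem fieldFun_B (ho : IsHallOrder lt) (hn : 1 ≤ n) (x : Phase (E.d n + 1)) :
    fieldFun (E.HeadQ n) (E.field n B) x = E.potentialEnergy n x.2 := by
  have hd := E.two_le_d ho hn
  have v2 : ((2 : Fin (E.d n + 1)) : ℕ) = 2 :=
    Nat.mod_eq_of_lt (show 2 < E.d n + 1 by omega)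
  have h0 : (2 : Fin (E.d n + 1)) ≠ 0 := fun h => by
    rw [h] at v2
    simp at v2
  have hU : E.U ((2 : Fin (E.d n + 1)) : ℕ) = B := by rw [v2, E.U_two]
  rw [fieldFun, Finset.sum_eq_single 2]
  · have hh : headVar (E.HeadQ n) x 2 = x.2 2 := if_pos (Or.inr (by rw [hU, degree]))
    rw [hh, field, fieldB, if_pos ⟨h0, hU⟩, map_one, mul_one, potentialEnergy]
  · intro k _ hk
    rw [field, fieldB, if_neg, map_zero, mul_zero]
    rintro ⟨hk0, hkB⟩
    exact hk (E.eq_of_U_eq hk0 h0 (hkB.trans hU.symm))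
  · simp

/-- The functions `(1/2) M(q)(p, p)` with a smooth symmetric matrix `M(q)`. -/
def IsKinetic {d : ℕ} (T : Phase d → ℝ) : Prop :=
  ∃ M : (Fin d → ℝ) → Matrix (Fin d) (Fin d) ℝ,
    (∀ q, (M q).IsSymm) ∧ (∀ i j, ContDiff ℝ ∞ fun q => M q i j) ∧
    ∀ p q, T (p, q) = 1 / 2 * ∑ i, ∑ j, M q i j * p i * p j

theorem isKinetic_mul {d : ℕ} {g : (Fin d → ℝ) → ℝ} (hg : ContDiff ℝ ∞ g) (a b : Fin d) :
    IsKinetic fun x => g x.2 * x.1 a * x.1 b := by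
  refine ⟨fun q i j => g q * ((if i = a then 1 else 0) * (if j = b then 1 else 0) +
    (if i = b then 1 else 0) * (if j = a then 1 else 0)), ?_, ?_, ?_⟩
  · intro q
    ext i j
    change g q * _ = g q * _
    ring
  · intro i j
    exact hg.mul contDiff_const
  · intro p q
    have : ∀ i j, g q * ((if i = a then 1 else 0) * (if j = b then 1 else 0) +
        (if i = b then 1 else 0) * (if j = a then 1 else 0)) * p i * p j =
        (if i = a then (if j = b then g q * p i * p j else 0) else 0) +
        (if i = b then (if j = a then g q * p i * p j else 0) else 0) := by
      intro i j
      split_ifs <;> ring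
    simp only [this, Finset.sum_add_distrib, Finset.sum_ite_irrel, Finset.sum_const_zero,
      Finset.sum_ite_eq', Finset.mem_univ, if_true]
    ring

theorem IsKinetic.add {d : ℕ} {T T' : Phase d → ℝ} (h : IsKinetic T) (h' : IsKinetic T') :
    IsKinetic (T + T') := by
  obtain ⟨M, h1, h2, h3⟩ := h
  obtain ⟨M', h1', h2', h3'⟩ := h'
  refine ⟨fun q => M q + M' q, fun q => (h1 q).add (h1' q), fun i j => (h2 i j).add (h2' i j), ?_⟩
  intro p q
  simp only [Pi.add_apply, h3, h3', Matrix.add_apply, add_mul, Finset.sum_add_distrib]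
  ring

theorem isKinetic_zero {d : ℕ} : IsKinetic (0 : Phase d → ℝ) :=
  ⟨fun _ => 0, fun _ => Matrix.isSymm_zero, fun _ _ => contDiff_const, by simp⟩

theorem contDiff_list_prod {d : ℕ} (l : List LieTree) (φ : LieTree → Fin d) :
    ContDiff ℝ ∞ fun q : Fin d → ℝ => (l.map fun z => q (φ z)).prod := by
  induction l with
  | nil => simpa using contDiff_const
  | cons x l ih =>
    simp only [List.map_cons, List.prod_cons]
    exact ContDiff.mul (by fun_prop) ih

theorem isKinetic_W (i : ℕ) : IsKinetic fun x : Phase (E.d n + 1) =>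
    E.W i (fun j => x.1 (Fin.ofNat _ j)) (fun j => x.2 (Fin.ofNat _ j)) := by
  have key : ∀ T : Phase (E.d n + 1) → ℝ, (∃ g : (Fin (E.d n + 1) → ℝ) → ℝ, ∃ a b,
      ContDiff ℝ ∞ g ∧ T = fun x => g x.2 * x.1 a * x.1 b) → IsKinetic T := by
    rintro T ⟨g, a, b, hg, rfl⟩
    exact isKinetic_mul hg a b
  apply key
  unfold W
  match (E.U i).factors with
  | [] => exact ⟨fun _ => 0, 0, 0, contDiff_const, by simp⟩
  | [x] =>
    by_cases hx : x.degree = 0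
    · exact ⟨fun _ => 1, Fin.ofNat _ i, Fin.ofNat _ (E.index x), contDiff_const, by simp [hx]⟩
    · exact ⟨fun q => q (Fin.ofNat _ (E.index x)), Fin.ofNat _ 0, Fin.ofNat _ i, by fun_prop,
        by funext y; simp only [hx, if_false]; ring⟩
  | x :: y :: l =>
    by_cases hx : x.degree = 0
    · by_cases hy : y.degree = 0
      · exact ⟨fun q => q (Fin.ofNat _ i), Fin.ofNat _ (E.index x), Fin.ofNat _ (E.index y),
          by fun_prop, by funext z; simp only [hx, hy, if_true]⟩
      · exact ⟨fun q => ((y :: l).map fun z => q (Fin.ofNat _ (E.index z))).prod, Fin.ofNat _ i,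
          Fin.ofNat _ (E.index x), contDiff_list_prod _ fun z => Fin.ofNat _ (E.index z),
          by funext z; simp only [hx, hy, if_true, if_false]; ring⟩
    · exact ⟨fun q => ((x :: y :: l).map fun z => q (Fin.ofNat _ (E.index z))).prod, Fin.ofNat _ 0,
        Fin.ofNat _ i, contDiff_list_prod _ fun z => Fin.ofNat _ (E.index z),
        by funext z; simp only [hx, if_false]; ring⟩

theorem isKinetic_kineticEnergy :
    IsKinetic fun x : Phase (E.d n + 1) => E.kineticEnergy n x.1 x.2 := by
  have hsum : ∀ s : Finset ℕ, IsKinetic (∑ i ∈ s, fun x : Phase (E.d n + 1) =>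
      E.W i (fun j => x.1 (Fin.ofNat _ j)) (fun j => x.2 (Fin.ofNat _ j))) := by
    intro s
    induction s using Finset.cons_induction with
    | empty => exact isKinetic_zero
    | cons a s ha ih =>
      rw [Finset.sum_cons]
      exact (E.isKinetic_W a).add ih
  convert (isKinetic_mul (g := fun _ => 1) contDiff_const (0 : Fin (E.d n + 1)) 1).add
    (hsum (Finset.Icc 3 (E.d n))) using 1
  funext x
  simp [kineticEnergy, Finset.sum_apply]

/-- The mechanical system with kinetic energy `p_0 p_1 + ∑ W_i` and potential energy `q_2`. -/
noncomputable def system (n : ℕ) : MechSystem (E.d n + 1) where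
  T x := E.kineticEnergy n x.1 x.2
  V q := E.potentialEnergy n q
  kinetic := E.isKinetic_kineticEnergy
  potential := by
    unfold potentialEnergy
    fun_prop

open scoped Classical in
theorem Phi_system (ho : IsHallOrder lt) (hn : 1 ≤ n) (t : LieTree) :
    (Phi (E.system n) t.toLP).toFun = fieldFun (E.HeadQ n) (E.field n t) := by
  induction t with
  | A =>
    rw [Phi_A]
    funext x
    exact (E.fieldFun_A ho hn x).symm
  | B =>
    rw [Phi_B]
    funext x
    exact (E.fieldFun_B ho hn x).symm
  | br x y hx hy =>
    rw [toLP_br, LieHom.map_lie, CPol.toFun_lie, hx, hy, poisson_fieldFun]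
    rfl

/-! ### The dual functionals -/

/-- The functional `F ↦ (∂F/∂p_i + ∂F/∂q_i)(p, q)` at `p = (1, 0, ..., 0)`, `q = 0`. -/
noncomputable def functional {N : ℕ} (i : Fin (N + 1)) : CPol (N + 1) →ₗ[ℝ] ℝ where
  toFun f := dp i f.toFun (Pi.single 0 1, 0) + dq i f.toFun (Pi.single 0 1, 0)
  map_add' f g := by
    rw [CPol.toFun_add, dp_add i f.mem g.mem, dq_add i f.mem g.mem, Pi.add_apply, Pi.add_apply]
    ring
  map_smul' c f := by
    simp only [CPol.toFun_smul, dp_smul, dq_smul, Pi.smul_apply, smul_eq_mul, RingHom.id_apply]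
    ring

theorem functional_ne_zero_iff (ho : IsHallOrder lt) (hn : 1 ≤ n) (i j : Fin (E.d n + 1))
    (hj : j ≠ 0) : functional i (Phi (E.system n) (E.U j).toLP) ≠ 0 ↔ i = j := by
  classical
  have h0 : E.HeadQ n 0 := Or.inl rfl
  have hh : headVar (E.HeadQ n) (Pi.single 0 1, 0) = 0 := by simp [headVar_single_p, h0]
  have hb : baseVar (E.HeadQ n) (Pi.single 0 1, 0) = Pi.single 0 1 := by
    simp [baseVar, headVar_single_p, h0]
  rw [← E.eval_field_ne_zero_iff ho hj]
  simp only [functional, LinearMap.coe_mk, AddHom.coe_mk]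
  rw [E.Phi_system ho hn, dp_fieldFun, dq_fieldFun]
  split_ifs <;> simp [hh, hb]

/-- The images of `U 1, U 2, ...`. -/
noncomputable def family (i : {i : ℕ // 1 ≤ i}) : LP := (E.U i).toLP

/-- A linear combination of `U 1, ..., U (d n)` is mapped to zero by `Φ` only if its coefficients
vanish. -/
theorem coeff_eq_zero (ho : IsHallOrder lt) (hn : 1 ≤ n) (c : {i : ℕ // 1 ≤ i} →₀ ℝ)
    (hc : ∀ j ∈ c.support, (j : ℕ) ≤ E.d n)
    (h : Phi (E.system n) (Finsupp.linearCombination ℝ E.family c) = 0) : c = 0 := by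
  by_contra hne
  obtain ⟨i, hi⟩ := Finsupp.support_nonempty_iff.mpr hne
  have hcoe : ∀ j ∈ c.support,
      functional (⟨i, Nat.lt_succ_of_le (hc i hi)⟩ : Fin (E.d n + 1))
        (Phi (E.system n) (E.family j)) ≠ 0 ↔ i = j := by
    intro j hj
    have := E.functional_ne_zero_iff ho hn ⟨i, Nat.lt_succ_of_le (hc i hi)⟩
      ⟨j, Nat.lt_succ_of_le (hc j hj)⟩ fun h => by
        have h1 := j.2
        have h2 : (j : ℕ) = 0 := congrArg Fin.val h
        omega
    rw [Fin.mk.injEq, ← Subtype.ext_iff] at this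
    exact this
  have h1 : functional (⟨i, Nat.lt_succ_of_le (hc i hi)⟩ : Fin (E.d n + 1))
      ((Phi (E.system n) : LP →ₗ[ℝ] CPol _) (Finsupp.linearCombination ℝ E.family c)) = 0 := by
    rw [LieHom.coe_toLinearMap, h, map_zero]
  rw [Finsupp.linearCombination_apply, Finsupp.sum, map_sum, map_sum,
    Finset.sum_eq_single_of_mem i hi] at h1
  · rw [map_smul, map_smul, smul_eq_mul, mul_eq_zero] at h1
    exact h1.elim (Finsupp.mem_support_iff.mp hi) ((hcoe i hi).mpr rfl)
  · intro j hj hji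
    have := (hcoe j hj).not.mpr (Ne.symm hji)
    rw [not_not] at this
    rw [map_smul, map_smul, LieHom.coe_toLinearMap, this, smul_zero]

theorem linearCombination_eq_zero (ho : IsHallOrder lt) (c : {i : ℕ // 1 ≤ i} →₀ ℝ)
    (h : ∀ n, 1 ≤ n → Phi (E.system n) (Finsupp.linearCombination ℝ E.family c) = 0) : c = 0 := by
  refine E.coeff_eq_zero (n := 1 + c.support.sup fun j => (E.U j).order) ho (by omega) c
    (fun j hj => E.le_d ho j.2 ?_) (h _ (by omega))
  have := Finset.le_sup (f := fun j : {i : ℕ // 1 ≤ i} => (E.U j).order) hj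
  omega

theorem linearIndependent_family (ho : IsHallOrder lt) : LinearIndependent ℝ E.family := by
  rw [linearIndependent_iff]
  intro c hc
  exact E.linearCombination_eq_zero ho c fun n _ => by rw [hc, map_zero]

theorem span_family (ho : IsHallOrder lt) : Submodule.span ℝ (Set.range E.family) = ⊤ := by
  rw [eq_top_iff, ← span_toLP_eq_top ho]
  refine Submodule.span_mono ?_
  rintro _ ⟨t, ht, rfl⟩
  obtain ⟨i, hi, rfl⟩ := E.surj t ht
  exact ⟨⟨i, hi⟩, rfl⟩

theorem ker_inf_upTo (ho : IsHallOrder lt) (hn : 1 ≤ n) :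
    (Phi (E.system n) : LP →ₗ[ℝ] CPol (E.d n + 1)).ker ⊓ E.upTo n = ⊥ := by
  rw [eq_bot_iff]
  rintro x ⟨hx, hx'⟩
  have hset : {z | ∃ i, 1 ≤ i ∧ i ≤ E.d n ∧ z = (E.U i).toLP} =
      E.family '' {i | (i : ℕ) ≤ E.d n} := by
    ext z
    constructor
    · rintro ⟨i, h1, h2, rfl⟩
      exact ⟨⟨i, h1⟩, h2, rfl⟩
    · rintro ⟨⟨i, h1⟩, h2, rfl⟩
      exact ⟨i, h1, h2, rfl⟩
  rw [SetLike.mem_coe, upTo, hset, Finsupp.mem_span_image_iff_linearCombination] at hx'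
  obtain ⟨c, hc, rfl⟩ := hx'
  have := E.coeff_eq_zero ho hn c (fun j hj => hc hj) hx
  simp [this]

end BasisEnum

/-! ### Existence of Hall orders and enumerations -/

namespace LieTree

/-- An injective numbering of the bracket expressions, used to break ties. -/
def code : LieTree → ℕ
  | A => 0
  | B => 1
  | br x y => Nat.pair x.code y.code + 2

theorem code_injective : Function.Injective code := by
  intro s
  induction s with
  | A => intro t h; cases t <;> simp_all [code]
  | B => intro t h; cases t <;> simp_all [code]
  | br x y hx hy =>
    intro t h
    cases t with
    | A => simp [code] at h
    | B => simp [code] at h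
    | br u v =>
      simp only [code, Nat.add_right_cancel_iff, Nat.pair_eq_pair] at h
      rw [hx h.1, hy h.2]

/-- The key by which the basis is enumerated: the order, then the numbering. -/
def key (t : LieTree) : ℕ ×ₗ ℕ := toLex (t.order, t.code)

theorem key_injective : Function.Injective key := fun _ _ h =>
  code_injective (congrArg Prod.snd (toLex.injective h))

theorem key_lt_of_order_lt {s t : LieTree} (h : s.order < t.order) : s.key < t.key :=
  Prod.Lex.toLex_lt_toLex.mpr (Or.inl h)

theorem order_le_of_key_le {s t : LieTree} (h : s.key ≤ t.key) : s.order ≤ t.order := by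
  by_contra! hlt
  exact (key_lt_of_order_lt hlt).not_ge h

end LieTree

theorem exists_isHallOrder : ∃ lt : LieTree → LieTree → Prop, IsHallOrder lt := by
  let κ : LieTree → ℕ ×ₗ (ℕ ×ₗ ℕ) := fun t => toLex (t.degree, t.key)
  have hκ : Function.Injective κ := fun _ _ h =>
    key_injective (congrArg Prod.snd (toLex.injective h))
  refine ⟨fun x y => κ x < κ y, ?_, ?_, ?_⟩
  · let e : (fun x y => κ x < κ y) ↪r ((· < ·) : ℕ ×ₗ (ℕ ×ₗ ℕ) → ℕ ×ₗ (ℕ ×ₗ ℕ) → Prop) :=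
      ⟨⟨κ, hκ⟩, Iff.rfl⟩
    exact e.isStrictTotalOrder
  · intro x y h
    exact Prod.Lex.toLex_lt_toLex.mpr (Or.inl h)
  · intro x y h1 h2
    exact Prod.Lex.toLex_lt_toLex.mpr (Or.inr ⟨h1, key_lt_of_order_lt h2⟩)

/-- The basis elements up to `t`, in the enumeration by increasing keys. -/
def initialSegment (lt : LieTree → LieTree → Prop) (t : LieTree) : Set LieTree :=
  {s | InBasis lt s ∧ s.key ≤ t.key}

theorem finite_initialSegment (t : LieTree) : (initialSegment lt t).Finite :=
  (finite_order_le t.order).subset fun _ hs => order_le_of_key_le hs.2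

theorem ncard_initialSegment_lt {s t : LieTree} (ht : InBasis lt t) (h : s.key < t.key) :
    (initialSegment lt s).ncard < (initialSegment lt t).ncard := by
  refine Set.ncard_lt_ncard ⟨fun u hu => ⟨hu.1, hu.2.trans h.le⟩, fun hsub => ?_⟩
    (finite_initialSegment t)
  exact h.not_ge (hsub ⟨ht, le_rfl⟩).2

theorem initialSegment_A : initialSegment lt A = {A} := by
  ext t
  simp only [initialSegment, Set.mem_ofPred_eq, Set.mem_singleton_iff]
  constructor
  · rintro ⟨-, h⟩
    by_contra hne
    have h1 : A.key < t.key := by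
      rw [key, key, Prod.Lex.toLex_lt_toLex]
      cases t with
      | A => exact absurd rfl hne
      | B => simp [order, code]
      | br x y =>
        have := x.order_pos
        have := y.order_pos
        left
        simp only [order]
        omega
    exact h1.not_ge h
  · rintro rfl
    exact ⟨trivial, le_rfl⟩

theorem initialSegment_B : initialSegment lt B = {A, B} := by
  ext t
  simp only [initialSegment, Set.mem_ofPred_eq, Set.mem_insert_iff, Set.mem_singleton_iff]
  constructor
  · rintro ⟨-, h⟩
    by_contra! hne
    have h1 : B.key < t.key := by
      cases t with
      | A => exact absurd rfl hne.1
      | B => exact absurd rfl hne.2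
      | br x y =>
        have := x.order_pos
        have := y.order_pos
        refine key_lt_of_order_lt ?_
        simp only [order]
        omega
    exact h1.not_ge h
  · rintro (rfl | rfl)
    · exact ⟨trivial, Prod.Lex.toLex_le_toLex.mpr (Or.inr ⟨rfl, by simp [code]⟩)⟩
    · exact ⟨trivial, le_rfl⟩

theorem exists_ncard_initialSegment (ho : IsHallOrder lt) (i : ℕ) (hi : 1 ≤ i) :
    ∃ t, InBasis lt t ∧ (initialSegment lt t).ncard = i := by
  induction i, hi using Nat.le_induction with
  | base => exact ⟨A, trivial, by rw [initialSegment_A, Set.ncard_singleton]⟩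
  | succ i _ ih =>
    obtain ⟨t, ht, hi⟩ := ih
    have hne : {s | InBasis lt s ∧ t.key < s.key}.Nonempty := by
      obtain ⟨s, hs, h⟩ := exists_inBasis_of_order ho t.order
      exact ⟨s, hs, key_lt_of_order_lt (by omega)⟩
    -- the successor of `t` is the smallest basis element with a larger key
    obtain ⟨s, ⟨hs, hts⟩, hmin⟩ :=
      (InvImage.wf LieTree.key (wellFounded_lt (α := ℕ ×ₗ ℕ))).has_min _ hne
    refine ⟨s, hs, ?_⟩
    have : initialSegment lt s = insert s (initialSegment lt t) := by
      ext u
      constructor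
      · rintro ⟨h1, h2⟩
        rcases h2.eq_or_lt with h3 | h3
        · exact Or.inl (key_injective h3)
        · refine Or.inr ⟨h1, ?_⟩
          by_contra! h4
          exact hmin u ⟨h1, h4⟩ h3
      · rintro (rfl | ⟨h1, h2⟩)
        · exact ⟨hs, le_rfl⟩
        · exact ⟨h1, h2.trans hts.le⟩
    rw [this, Set.ncard_insert_of_notMem (fun h => hts.not_ge h.2) (finite_initialSegment t), hi]

theorem nonempty_basisEnum (ho : IsHallOrder lt) : Nonempty (BasisEnum lt) := by
  have hinj : ∀ s t, InBasis lt s → InBasis lt t →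
      (initialSegment lt s).ncard = (initialSegment lt t).ncard → s = t := by
    intro s t hs ht h
    rcases lt_trichotomy s.key t.key with h1 | h1 | h1
    · have := ncard_initialSegment_lt ht h1
      omega
    · exact key_injective h1
    · have := ncard_initialSegment_lt hs h1
      omega
  have hpos : ∀ t, InBasis lt t → 1 ≤ (initialSegment lt t).ncard := fun t ht =>
    (Set.ncard_pos (finite_initialSegment t)).mpr ⟨t, ht, le_rfl⟩
  have hfin : ∀ n, {t | InBasis lt t ∧ t.order ≤ n}.Finite := fun n =>
    (finite_order_le n).subset fun t ht => ht.2
  have hle : ∀ n t, InBasis lt t → (t.order ≤ n ↔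
      (initialSegment lt t).ncard ≤ {t | InBasis lt t ∧ t.order ≤ n}.ncard) := by
    intro n t ht
    constructor
    · intro h
      exact Set.ncard_le_ncard (fun s hs => ⟨hs.1, (order_le_of_key_le hs.2).trans h⟩) (hfin n)
    · contrapose!
      intro h
      refine Set.ncard_lt_ncard ⟨fun s hs =>
        ⟨hs.1, (key_lt_of_order_lt (hs.2.trans_lt h)).le⟩, fun hsub => ?_⟩
        (finite_initialSegment t)
      exact h.not_ge (hsub ⟨ht, le_rfl⟩).2
  choose U hU using fun i : ℕ => exists_ncard_initialSegment ho (max i 1) (le_max_right _ _)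
  have hU' : ∀ i, 1 ≤ i → (initialSegment lt (U i)).ncard = i := fun i hi => by
    rw [(hU i).2, max_eq_left hi]
  refine ⟨{
    U := U
    d := fun n => {t | InBasis lt t ∧ t.order ≤ n}.ncard
    mem := fun i _ => (hU i).1
    surj := fun t ht => ⟨_, hpos t ht, hinj _ _ (hU _).1 ht (hU' _ (hpos t ht))⟩
    inj := fun i j hi hj h => by rw [← hU' i hi, ← hU' j hj, h]
    U_one := hinj _ _ (hU _).1 trivial (by
      rw [hU' 1 le_rfl, initialSegment_A, Set.ncard_singleton])
    U_two := hinj _ _ (hU _).1 trivial (by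
      rw [hU' 2 (by omega), initialSegment_B, Set.ncard_pair (by simp)])
    d_zero := ?_
    order_iff := ?_ }⟩
  · rw [Set.ncard_eq_zero (hfin 0)]
    ext t
    have := t.order_pos
    simp only [Set.mem_ofPred_eq, Set.mem_empty_iff_false, iff_false]
    omega
  · intro n i hn hi
    have h1 := hle n (U i) (hU i).1
    have h2 := hle (n - 1) (U i) (hU i).1
    rw [hU' i hi] at h1 h2
    rw [← h1, ← not_le, ← h2]
    omega

end MechLie

theorem theorem2 :
    (∃ lt : MechLie.LieTree → MechLie.LieTree → Prop,
      MechLie.IsHallOrder lt ∧ Nonempty (MechLie.BasisEnum lt)) ∧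
    (∀ lt : MechLie.LieTree → MechLie.LieTree → Prop, MechLie.IsHallOrder lt →
      ∀ E : MechLie.BasisEnum lt,
        (LinearIndependent ℝ (fun i : {i : ℕ // 1 ≤ i} => (E.U i).toLP) ∧
          Submodule.span ℝ (Set.range fun i : {i : ℕ // 1 ≤ i} => (E.U i).toLP) = ⊤) ∧
        ∀ n : ℕ, 1 ≤ n → ∃ S : MechLie.MechSystem (E.d n + 1),
          (∀ p q, S.T (p, q) = E.kineticEnergy n p q) ∧
          (∀ q, S.V q = E.potentialEnergy n q) ∧
          (∀ i j : Fin (E.d n + 1), i ≠ 0 → j ≠ 0 →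
            (MechLie.dp i (MechLie.Phi S (E.U j).toLP).toFun (Pi.single 0 1, 0) +
              MechLie.dq i (MechLie.Phi S (E.U j).toLP).toFun (Pi.single 0 1, 0) ≠ 0 ↔ i = j)) ∧
          (MechLie.Phi S : MechLie.LP →ₗ[ℝ] MechLie.CPol (E.d n + 1)).ker ⊓ E.upTo n = ⊥) ∧
    (⨅ (d : ℕ) (_ : 1 ≤ d) (S : MechLie.MechSystem d),
      (MechLie.Phi S : MechLie.LP →ₗ[ℝ] MechLie.CPol d).ker) = ⊥ := by
  obtain ⟨lt, ho⟩ := MechLie.exists_isHallOrder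
  obtain ⟨E⟩ := MechLie.nonempty_basisEnum ho
  refine ⟨⟨lt, ho, ⟨E⟩⟩, fun lt ho E => ⟨⟨E.linearIndependent_family ho, E.span_family ho⟩,
    fun n hn => ⟨E.system n, fun _ _ => rfl, fun _ => rfl,
      fun i j _ hj => E.functional_ne_zero_iff ho hn i j hj, E.ker_inf_upTo ho hn⟩⟩, ?_⟩
  rw [eq_bot_iff]
  intro x hx
  have hx' : ∀ n, 1 ≤ n → MechLie.Phi (E.system n) x = 0 := by
    intro n _
    simp only [Submodule.mem_iInf] at hx
    exact hx (E.d n + 1) (by omega) (E.system n)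
  have htop : x ∈ Submodule.span ℝ (Set.range E.family) := by
    rw [E.span_family ho]
    trivial
  obtain ⟨c, rfl⟩ := (Finsupp.mem_span_range_iff_exists_finsupp).mp htop
  have := E.linearCombination_eq_zero ho c hx'
  simp [this]
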